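/- \textbf{Theorem (Annealed SLLN for $\mathrm{GRG}_N(\boldsymbol w)$).} For every $N\ge 1$ let $\boldsymbol w=\boldsymbol w^{(N)}=(w_i)_{i\in[N]}$ be deterministic weights $w_i>0$ (which may depend on $N$), let $\ell_N=\sum_{i\in[N]}w_i$, and let $\mathrm{GRG}_N(\boldsymbol w)$ be the random simple graph on $[N]=\{1,\dots,N\}$ in which the edges $\{i,j\}$, $i<j$, are present independently with probabilities $p_{ij}=\frac{w_iw_j}{\ell_N+w_iw_j}$. Write $Q_N$ for the expectation over this graph and $E_N$ for its edge set. Let $W_N=w_{I_N}$ with $I_N$ uniform on $[N]$, and assume that there is a random variable $W$ such that, as $N\to\infty$, $$W_N\xrightarrow{\ \mathcal D\ }W,\qquad \mathbb E[W_N]=\tfrac1N\sum_{i\in[N]}w_i\to\mathbb E[W]<\infty,\qquad \mathbb E[W_N^2]=\tfrac1N\sum_{i\in[N]}w_i^2\to\mathbb E[W^2]<\infty,$$ and $\mathbb E[W]>0$. For $\beta\ge 0$ and $B\in\mathbb R$, the annealed Ising measure on $\{-1,1\}^N$ is $$\widetilde P_N(\sigma)=\frac{Q_N\big(\exp\big[\beta\sum_{(i,j)\in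 E_N}\sigma_i\sigma_j+B\sum_{i\in[N]}\sigma_i\big]\big)}{Q_N\big(\sum_{\sigma'\in\{-1,1\}^N}\exp\big[\beta\sum_{(i,j)\in E_N}\sigma'_i\sigma'_j+B\sum_{i\in[N]}\sigma'_i\big]\big)},$$ where each edge is counted once. Let $S_N=\sum_{i\in[N]}\sigma_i$, let $\widetilde M_N(\beta,B)=\widetilde P_N(S_N/N)$ be the mean of $S_N/N$ under $\widetilde P_N$, and let $\widetilde M(\beta,B)=\lim_{N\to\infty}\widetilde M_N(\beta,B)$ whenever this limit exists. Let $$\beta_c^{\mathrm{an}}=\inf\Big\{\beta>0:\ \lim_{B\to0^+}\widetilde M(\beta,B)>0\Big\},\qquad \mathcal U^{\mathrm{an}}=\big\{(\beta,B):\ \beta\ge0,\ B\ne0,\ \text{ or }\ 0<\beta<\beta_c^{\mathrm{an}},\ B=0\big\},$$ where a $\beta$ belongs to the set only if $\widetilde M(\beta,B)$ exists for all $B>0$ and has a limit as $B\to0^+$, and $\inf\emptyset=+\infty$. Then for every $(\beta,B)\in\mathcal U^{\mathrm{an}}$ the limit $\widetilde M=\widetilde M(\beta,B)$ exists, and for every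 $\varepsilon>0$ there is $L=L(\varepsilon)>0$ such that $$\widetilde P_N\left(\left|\frac{S_N}{N}-\widetilde M\right|\ge\varepsilon\right)\le e^{-NL}\qquad\text{for all sufficiently large }N .$$ -/

import Mathlib

open MeasureTheory ProbabilityTheory Filter Topology
open scoped BigOperators

namespace AnnealedIsing

noncomputable section

/-! ### The generalized random graph -/

/-- The total vertex weight `ℓ_N = ∑ i, w i`. -/
def totalWeight {N : ℕ} (w : Fin N → ℝ) : ℝ := ∑ i, w i

/-- The edge probability `p_ij = w_i w_j / (ℓ_N + w_i w_j)`, as an element of `[0, 1]`.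
The projection onto `[0, 1]` changes nothing for positive weights, see `coe_edgeProb`. -/
def edgeProb {N : ℕ} (w : Fin N → ℝ) (i j : Fin N) : unitInterval :=
  Set.projIcc 0 1 zero_le_one (w i * w j / (totalWeight w + w i * w j))

theorem coe_edgeProb {N : ℕ} {w : Fin N → ℝ} (hw : ∀ i, 0 < w i) (i j : Fin N) :
    (edgeProb w i j : ℝ) = w i * w j / (totalWeight w + w i * w j) := by
  have h1 : 0 < w i * w j := mul_pos (hw i) (hw j)
  have h2 : 0 ≤ totalWeight w := Finset.sum_nonneg fun k _ => (hw k).le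
  have h3 : w i * w j / (totalWeight w + w i * w j) ∈ Set.Icc (0 : ℝ) 1 :=
    ⟨by positivity, div_le_one_of_le₀ (by linarith) (by linarith)⟩
  simp [edgeProb, Set.projIcc_of_mem zero_le_one h3]

/-- The unordered pairs of distinct vertices, each represented by the pair `(i, j)` with `i < j`. -/
abbrev VertexPair (N : ℕ) : Type := {e : Fin N × Fin N // e.1 < e.2}

/-- The simple graph whose edges are the pairs with indicator `true`. -/
def graphOfIndicators {N : ℕ} (X : VertexPair N → Bool) : SimpleGraph (Fin N) :=
  SimpleGraph.fromRel fun i j => ∃ h : i < j, X ⟨(i, j), h⟩ = true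

/-- The law of the generalized random graph: the edge indicators are independent, and that of
`{i, j}` is Bernoulli with parameter `p_ij`. -/
def grgLaw {N : ℕ} (w : Fin N → ℝ) : Measure (SimpleGraph (Fin N)) :=
  (Measure.pi fun e : VertexPair N =>
    bernoulliMeasure true false (edgeProb w e.1.1 e.1.2)).map graphOfIndicators

/-! ### The annealed Ising measure -/

/-- Spin configurations: `ℤˣ = {1, -1}`. -/
abbrev SpinConfig (N : ℕ) : Type := Fin N → ℤˣ

/-- The spin at a vertex as a real number. -/
def spin {N : ℕ} (σ : SpinConfig N) (i : Fin N) : ℝ := ((σ i : ℤ) : ℝ)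

/-- The total spin `S_N`. -/
def totalSpin {N : ℕ} (σ : SpinConfig N) : ℝ := ∑ i, spin σ i

open Classical in
/-- The sum of `σ_i σ_j` over the edges of `G`, each edge being counted once. -/
def edgeInteraction {N : ℕ} (G : SimpleGraph (Fin N)) (σ : SpinConfig N) : ℝ :=
  ∑ i, ∑ j, if i < j ∧ G.Adj i j then spin σ i * spin σ j else 0

/-- The Boltzmann factor `exp (β ∑_{(i,j) ∈ E} σ_i σ_j + B ∑_i σ_i)` on the graph `G`. -/
def boltzmannFactor {N : ℕ} (β B : ℝ) (G : SimpleGraph (Fin N)) (σ : SpinConfig N) : ℝ :=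
  Real.exp (β * edgeInteraction G σ + B * totalSpin σ)

/-- The partition function on the graph `G`. -/
def partitionFunction {N : ℕ} (β B : ℝ) (G : SimpleGraph (Fin N)) : ℝ :=
  ∑ σ : SpinConfig N, boltzmannFactor β B G σ

/-- The annealed probability of a single spin configuration. -/
def annealedProb {N : ℕ} (w : Fin N → ℝ) (β B : ℝ) (σ : SpinConfig N) : ℝ :=
  (∫ G, boltzmannFactor β B G σ ∂grgLaw w) / ∫ G, partitionFunction β B G ∂grgLaw w

/-- The annealed measure on spin configurations. -/
def annealedMeasure {N : ℕ} (w : Fin N → ℝ) (β B : ℝ) : Measure (SpinConfig N) :=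
  ∑ σ : SpinConfig N, ENNReal.ofReal (annealedProb w β B σ) • Measure.dirac σ

/-- The finite-volume annealed magnetization: the annealed mean of `S_N / N`. -/
def annealedMagnetization {N : ℕ} (w : Fin N → ℝ) (β B : ℝ) : ℝ :=
  ∫ σ, totalSpin σ / (N : ℝ) ∂annealedMeasure w β B

/-! ### Weight regularity, critical temperature and uniqueness regime

A family of weights `w` gives a vector `w N` of `N` weights for every `N`. -/

/-- `M` is the thermodynamic limit of the annealed magnetization at `(β, B)`. -/
def IsLimitMagnetization (w : (N : ℕ) → Fin N → ℝ) (β B M : ℝ) : Prop :=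
  Tendsto (fun N : ℕ => annealedMagnetization (w N) β B) atTop (𝓝 M)

/-- `m` is the spontaneous magnetization at `β`: the limit, as `B` decreases to `0`, of the
thermodynamic limit of the magnetization. -/
def IsSpontaneousMagnetization (w : (N : ℕ) → Fin N → ℝ) (β m : ℝ) : Prop :=
  ∃ M : ℝ → ℝ, (∀ B, 0 < B → IsLimitMagnetization w β B (M B)) ∧ Tendsto M (𝓝[>] 0) (𝓝 m)

/-- The annealed critical inverse temperature: the infimum (`⊤` if there are none) of the `β > 0`
with positive spontaneous magnetization. -/
def criticalInverseTemperature (w : (N : ℕ) → Fin N → ℝ) : EReal :=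
  sInf {b : EReal | ∃ β : ℝ, b = (β : EReal) ∧ 0 < β ∧
    ∃ m : ℝ, 0 < m ∧ IsSpontaneousMagnetization w β m}

/-- The annealed uniqueness regime. -/
def uniquenessRegime (w : (N : ℕ) → Fin N → ℝ) : Set (ℝ × ℝ) :=
  {q | (0 ≤ q.1 ∧ q.2 ≠ 0) ∨ (0 < q.1 ∧ (q.1 : EReal) < criticalInverseTemperature w ∧ q.2 = 0)}

/-- Weight regularity with limiting random variable `W`: the weight `W_N` of a uniform vertex
converges to `W` in distribution, its first and second moments converge to those of `W`, these are
finite, and `E[W] > 0`. In the first field the index is shifted by one, so that the vertex set is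
not empty. -/
structure WeightRegularity (w : (N : ℕ) → Fin N → ℝ) {Ω : Type*} [MeasurableSpace Ω]
    (P : Measure Ω) [IsProbabilityMeasure P] (W : Ω → ℝ) : Prop where
  tendsto_dist : TendstoInDistribution (fun (N : ℕ) (i : Fin (N + 1)) => w (N + 1) i) atTop W
    (fun N : ℕ => uniformOn (Set.univ : Set (Fin (N + 1)))) P
  integrable : Integrable W P
  tendsto_mean : Tendsto (fun N : ℕ => (1 / (N : ℝ)) * ∑ i, w N i) atTop (𝓝 (∫ x, W x ∂P))
  integrable_sq : Integrable (fun x => W x ^ 2) P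
  tendsto_mean_sq :
    Tendsto (fun N : ℕ => (1 / (N : ℝ)) * ∑ i, w N i ^ 2) atTop (𝓝 (∫ x, W x ^ 2 ∂P))
  mean_pos : 0 < ∫ x, W x ∂P

end

end AnnealedIsing

/-!
Averaging over the random graph turns each factor `exp (β σ_i σ_j)` into
`(1 + x e^{β σ_i σ_j}) / (1 + x)` with the odds `x = w_i w_j / ℓ_N`. Up to a factor that does not
depend on `σ` and an error `e^{o(N)}` this is `exp (sinh β · x σ_i σ_j)`, so the annealed model is
compared with the Curie-Weiss model with weight `exp (sinh β (∑ w_i σ_i)² / (2 ℓ_N) + B ∑ σ_i)`.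
Linearizing the square at `z ℓ_N` shows that its pressure is the maximum over `z ∈ [-1, 1]` of
`E[log (2 cosh (a z W + B))] - a E[W] z² / 2`, where `a = sinh β`.

The scaled cumulant generating functions of `S_N` therefore converge to increments of this
pressure, and by the Chernoff bound `S_N / N` concentrates exponentially fast around its derivative
in `B`. For `B ≠ 0` the derivative exists because the maximizer is unique and depends continuously
on `B`. For `B = 0` the pressure is even and convex, its right derivative is the spontaneous
magnetization, and the latter vanishes below the critical inverse temperature.
-/

namespace AnnealedIsing

noncomputable section

/-! ### Convergence of expectations under weak convergence -/

section WeakConvergence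

variable {ι E Ω' : Type*} {Ω : ι → Type*} {m : ∀ i, MeasurableSpace (Ω i)}
  {μ : (i : ι) → Measure (Ω i)} [∀ i, IsProbabilityMeasure (μ i)]
  {m' : MeasurableSpace Ω'} {μ' : Measure Ω'} [IsProbabilityMeasure μ']
  [TopologicalSpace E] {mE : MeasurableSpace E} [OpensMeasurableSpace E]
  {X : (i : ι) → Ω i → E} {Z : Ω' → E} {l : Filter ι}

open BoundedContinuousFunction in
theorem tendsto_integral_comp_boundedContinuous (hX : TendstoInDistribution X l Z μ μ')
    (f : E →ᵇ ℝ) : Tendsto (fun i => ∫ ω, f (X i ω) ∂μ i) l (𝓝 (∫ ω, f (Z ω) ∂μ')) := by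
  have h := ProbabilityMeasure.tendsto_iff_forall_integral_tendsto.1 hX.tendsto f
  simp only [ProbabilityMeasure.coe_mk] at h
  rw [integral_map hX.aemeasurable_limit f.continuous.measurable.aestronglyMeasurable] at h
  refine h.congr fun i => ?_
  rw [integral_map (hX.forall_aemeasurable i) f.continuous.measurable.aestronglyMeasurable]

/-- A form of Fatou's lemma. -/
theorem eventually_lt_integral_comp (hX : TendstoInDistribution X l Z μ μ') {h : E → ℝ}
    (hc : Continuous h) (h0 : ∀ x, 0 ≤ h x) (hi : ∀ i, Integrable (fun ω => h (X i ω)) (μ i))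
    (hZ : Integrable (fun ω => h (Z ω)) μ') {c : ℝ} (hlt : c < ∫ ω, h (Z ω) ∂μ') :
    ∀ᶠ i in l, c < ∫ ω, h (X i ω) ∂μ i := by
  let trunc (K : ℕ) : BoundedContinuousFunction E ℝ :=
    BoundedContinuousFunction.ofNormedAddCommGroup (fun x => min (h x) K) (by fun_prop) K
      fun x => by
        rw [Real.norm_of_nonneg (le_min (h0 x) K.cast_nonneg)]
        exact min_le_right _ _
  have hlim : Tendsto (fun K => ∫ ω, trunc K (Z ω) ∂μ') atTop (𝓝 (∫ ω, h (Z ω) ∂μ')) := by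
    refine tendsto_integral_of_dominated_convergence (fun ω => h (Z ω))
      (fun K => ((trunc K).continuous.measurable.comp_aemeasurable
        hX.aemeasurable_limit).aestronglyMeasurable) hZ (fun K => ae_of_all _ fun ω => ?_)
      (ae_of_all _ fun ω => tendsto_const_nhds.congr' ?_)
    · exact (Real.norm_of_nonneg (le_min (h0 _) K.cast_nonneg)).trans_le (min_le_left _ _)
    · filter_upwards [eventually_ge_atTop ⌈h (Z ω)⌉₊] with K hK
      exact (min_eq_left (Nat.ceil_le.1 hK)).symm
  obtain ⟨K, hK⟩ := (hlim.eventually_const_lt hlt).exists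
  filter_upwards [(tendsto_integral_comp_boundedContinuous hX (trunc K)).eventually_const_lt hK]
    with i hi'
  exact hi'.trans_le (integral_mono_of_nonneg
    (ae_of_all _ fun ω => le_min (h0 _) K.cast_nonneg) (hi i)
    (ae_of_all _ fun ω => min_le_left _ _))

theorem eventually_lt_integral_comp_of_abs_le (hX : TendstoInDistribution X l Z μ μ') {f g : E → ℝ}
    (hf : Continuous f) (hg : Continuous g) (hfg : ∀ x, |f x| ≤ g x)
    (hgi : ∀ i, Integrable (fun ω => g (X i ω)) (μ i)) (hgZ : Integrable (fun ω => g (Z ω)) μ')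
    (hlim : Tendsto (fun i => ∫ ω, g (X i ω) ∂μ i) l (𝓝 (∫ ω, g (Z ω) ∂μ')))
    {c : ℝ} (hlt : c < ∫ ω, f (Z ω) ∂μ') : ∀ᶠ i in l, c < ∫ ω, f (X i ω) ∂μ i := by
  have hfi (i) : Integrable (fun ω => f (X i ω)) (μ i) := (hgi i).mono'
    (hf.measurable.comp_aemeasurable (hX.forall_aemeasurable i)).aestronglyMeasurable
    (ae_of_all _ fun ω => hfg _)
  have hfZ : Integrable (fun ω => f (Z ω)) μ' := hgZ.mono'
    (hf.measurable.comp_aemeasurable hX.aemeasurable_limit).aestronglyMeasurable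
    (ae_of_all _ fun ω => hfg _)
  obtain ⟨c', hcc', hc'⟩ := exists_between hlt
  have hsum : ∀ᶠ i in l, c' + ∫ ω, g (Z ω) ∂μ' < ∫ ω, (f (X i ω) + g (X i ω)) ∂μ i :=
    eventually_lt_integral_comp hX (h := fun x => f x + g x) (hf.add hg)
      (fun x => by linarith [neg_abs_le (f x), hfg x]) (fun i => (hfi i).add (hgi i))
      (hfZ.add hgZ) (by rw [integral_add hfZ hgZ]; linarith)
  filter_upwards [hsum, hlim.eventually_lt_const (lt_add_of_pos_right _ (sub_pos.2 hcc'))]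
    with i h1 h2
  rw [integral_add (hfi i) (hgi i)] at h1
  linarith

/-- A form of the generalized dominated convergence theorem. -/
theorem tendsto_integral_comp_of_abs_le (hX : TendstoInDistribution X l Z μ μ') {f g : E → ℝ}
    (hf : Continuous f) (hg : Continuous g) (hfg : ∀ x, |f x| ≤ g x)
    (hgi : ∀ i, Integrable (fun ω => g (X i ω)) (μ i)) (hgZ : Integrable (fun ω => g (Z ω)) μ')
    (hlim : Tendsto (fun i => ∫ ω, g (X i ω) ∂μ i) l (𝓝 (∫ ω, g (Z ω) ∂μ'))) :
    Tendsto (fun i => ∫ ω, f (X i ω) ∂μ i) l (𝓝 (∫ ω, f (Z ω) ∂μ')) := by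
  refine tendsto_order.2
    ⟨fun c hc => eventually_lt_integral_comp_of_abs_le hX hf hg hfg hgi hgZ hlim hc, fun c hc => ?_⟩
  have hneg := eventually_lt_integral_comp_of_abs_le hX (f := fun x => -f x) hf.neg hg
    (fun x => (abs_neg _).trans_le (hfg x)) hgi hgZ hlim (c := -c)
    (by rw [integral_neg]; exact neg_lt_neg hc)
  filter_upwards [hneg] with i hi
  rw [integral_neg] at hi
  exact neg_lt_neg_iff.1 hi

theorem ae_mem_of_tendstoInDistribution [HasOuterApproxClosed E] [l.NeBot]
    (hX : TendstoInDistribution X l Z μ μ') {F : Set E} (hF : IsClosed F)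
    (hmem : ∀ i, ∀ᵐ ω ∂μ i, X i ω ∈ F) : ∀ᵐ ω ∂μ', Z ω ∈ F := by
  have h := ProbabilityMeasure.le_liminf_measure_open_of_tendsto hX.tendsto hF.isOpen_compl
  simp only [ProbabilityMeasure.coe_mk] at h
  have h0 (i) : (μ i).map (X i) Fᶜ = 0 := by
    rw [Measure.map_apply_of_aemeasurable (hX.forall_aemeasurable i) hF.isOpen_compl.measurableSet]
    exact hmem i
  rw [Measure.map_apply_of_aemeasurable hX.aemeasurable_limit hF.isOpen_compl.measurableSet] at h
  simp only [h0, liminf_const, nonpos_iff_eq_zero] at h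
  exact h

end WeakConvergence

theorem tendsto_integral_mul_min {Ω : Type*} [MeasurableSpace Ω] {P : Measure Ω}
    {W : Ω → ℝ} (hW : Integrable W P) :
    Tendsto (fun T : ℝ => ∫ x, W x * min 1 (W x ^ 2 / T) ∂P) atTop (𝓝 0) := by
  rw [← integral_zero Ω ℝ]
  refine tendsto_integral_filter_of_dominated_convergence (fun x => |W x|) (.of_forall fun T => ?_)
    ?_ hW.abs (ae_of_all _ fun x => ?_)
  · exact hW.1.mul (Continuous.comp_aestronglyMeasurable (g := fun y => min 1 (y ^ 2 / T))
      (by fun_prop) hW.1)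
  · filter_upwards [eventually_ge_atTop 0] with T hT
    refine ae_of_all _ fun x => ?_
    have hmin : 0 ≤ min 1 (W x ^ 2 / T) := by positivity
    rw [norm_mul, Real.norm_of_nonneg hmin, Real.norm_eq_abs]
    exact mul_le_of_le_one_right (abs_nonneg _) (min_le_left _ _)
  · have hmin : Tendsto (fun T : ℝ => min 1 (W x ^ 2 / T)) atTop (𝓝 (min 1 0)) :=
      tendsto_const_nhds.min (tendsto_const_nhds.div_atTop tendsto_id)
    simpa using hmin.const_mul (W x)

theorem card_mul_integral_uniformOn_univ {α : Type*} [Fintype α] [MeasurableSpace α]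
    [MeasurableSingletonClass α] (f : α → ℝ) :
    (Fintype.card α : ℝ) * ∫ i, f i ∂uniformOn (Set.univ : Set α) = ∑ i, f i := by
  rcases isEmpty_or_nonempty α with h | h
  · simp
  · simp [uniformOn, ProbabilityTheory.cond, integral_smul_measure]

/-! ### Exponential concentration from the limit of the scaled cumulant generating functions -/

/-- The sequence `u` is eventually at most `exp (-N L)` for some rate `L > 0`. -/
def DecaysExponentially (u : ℕ → ℝ) : Prop :=
  ∃ L, 0 < L ∧ ∀ᶠ N : ℕ in atTop, u N ≤ Real.exp (-(N * L))

theorem DecaysExponentially.add {u v : ℕ → ℝ} (hu : DecaysExponentially u)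
    (hv : DecaysExponentially v) : DecaysExponentially (u + v) := by
  obtain ⟨L₁, hL₁, hu⟩ := hu
  obtain ⟨L₂, hL₂, hv⟩ := hv
  set L := min L₁ L₂ / 2 with hL
  have hLpos : 0 < L := by positivity
  refine ⟨L, hLpos, ?_⟩
  have hlarge := (tendsto_natCast_atTop_atTop (R := ℝ)).eventually_ge_atTop (Real.log 2 / L)
  filter_upwards [hu, hv, hlarge] with N huN hvN hN
  have hexp {L' : ℝ} (hL' : 2 * L ≤ L') :
      Real.exp (-(N * L')) ≤ Real.exp (-(N * L)) / 2 := by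
    rw [← Real.exp_log two_pos, ← Real.exp_sub, Real.exp_le_exp]
    rw [div_le_iff₀ hLpos] at hN
    have := mul_le_mul_of_nonneg_left hL' (N.cast_nonneg (α := ℝ))
    linarith
  calc u N + v N ≤ Real.exp (-(N * L)) / 2 + Real.exp (-(N * L)) / 2 :=
        add_le_add (huN.trans (hexp (by linarith [min_le_left L₁ L₂])))
          (hvN.trans (hexp (by linarith [min_le_right L₁ L₂])))
    _ = Real.exp (-(N * L)) := add_halves _

theorem DecaysExponentially.tendsto_zero {u : ℕ → ℝ} (hu : DecaysExponentially u)
    (hu0 : ∀ N, 0 ≤ u N) : Tendsto u atTop (𝓝 0) := by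
  obtain ⟨L, hL, hu⟩ := hu
  have hexp : Tendsto (fun N : ℕ => Real.exp (-(N * L))) atTop (𝓝 0) :=
    Real.tendsto_exp_neg_atTop_nhds_zero.comp (tendsto_natCast_atTop_atTop.atTop_mul_const hL)
  exact squeeze_zero' (Eventually.of_forall hu0) hu hexp

theorem hasDerivAt_comp_neg {f : ℝ → ℝ} {f' x : ℝ} (hf : HasDerivAt f f' (-x)) :
    HasDerivAt (fun y => f (-y)) (-f') x := by
  simpa [Function.comp_def] using hf.scomp x (hasDerivAt_neg x)

section Concentration

variable {Ω : ℕ → Type*} {m : ∀ N, MeasurableSpace (Ω N)} {μ : (N : ℕ) → Measure (Ω N)}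
  {S : (N : ℕ) → Ω N → ℝ} {Λ : ℝ → ℝ} {M ε : ℝ}

/-- Chernoff's bound at a small parameter `t`: since `Λ t = M t + o(t)`, the exponent
`Λ t - t (M + ε)` is negative. -/
theorem decaysExponentially_measureReal_ge [∀ N, IsFiniteMeasure (μ N)]
    (hint : ∀ N t, Integrable (fun ω => Real.exp (t * S N ω)) (μ N))
    (hcgf : ∀ t, Tendsto (fun N : ℕ => cgf (S N) (μ N) t / N) atTop (𝓝 (Λ t)))
    (h0 : Λ 0 = 0) (hΛ : HasDerivAt Λ M 0) (hε : 0 < ε) :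
    DecaysExponentially fun N => (μ N).real {ω | N * (M + ε) ≤ S N ω} := by
  obtain ⟨t, ht, htΛ⟩ : ∃ t, 0 < t ∧ Λ t < t * (M + ε) := by
    have hslope := hΛ.tendsto_slope_zero_right
    obtain ⟨t, hlt, ht⟩ := ((hslope.eventually_lt_const (lt_add_of_pos_right M hε)).and
      self_mem_nhdsWithin).exists
    refine ⟨t, ht, ?_⟩
    rwa [zero_add, h0, sub_zero, smul_eq_mul, inv_mul_lt_iff₀ ht] at hlt
  obtain ⟨c, hΛc, hct⟩ := exists_between htΛ
  refine ⟨t * (M + ε) - c, sub_pos.2 hct, ?_⟩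
  filter_upwards [(hcgf t).eventually_lt_const hΛc, eventually_gt_atTop 0] with N hN hN0
  refine (measure_ge_le_exp_cgf _ ht.le (hint N t)).trans (Real.exp_le_exp.2 ?_)
  have : cgf (S N) (μ N) t < c * N := (div_lt_iff₀ (by positivity)).1 hN
  linarith

/-- The easy half of the Gärtner-Ellis theorem. -/
theorem decaysExponentially_measureReal_abs_sub_ge [∀ N, IsFiniteMeasure (μ N)]
    (hint : ∀ N t, Integrable (fun ω => Real.exp (t * S N ω)) (μ N))
    (hcgf : ∀ t, Tendsto (fun N : ℕ => cgf (S N) (μ N) t / N) atTop (𝓝 (Λ t)))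
    (h0 : Λ 0 = 0) (hΛ : HasDerivAt Λ M 0) (hε : 0 < ε) :
    DecaysExponentially fun N => (μ N).real {ω | ε ≤ |S N ω / N - M|} := by
  have hΛneg : HasDerivAt (fun t => Λ (-t)) (-M) 0 := hasDerivAt_comp_neg (by rwa [neg_zero])
  have hupper := decaysExponentially_measureReal_ge hint hcgf h0 hΛ hε
  have hlower := decaysExponentially_measureReal_ge (S := fun N => -S N)
    (fun N t => by simpa using hint N (-t)) (fun t => by simpa only [cgf_neg] using hcgf (-t))
    (by simpa using h0) hΛneg hε
  obtain ⟨L, hL, hsum⟩ := hupper.add hlower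
  refine ⟨L, hL, ?_⟩
  filter_upwards [hsum, eventually_gt_atTop 0] with N hN hN0
  refine le_trans ((measureReal_mono fun ω hω => ?_).trans (measureReal_union_le _ _)) hN
  have hS : S N ω = N * (S N ω / N) := by field_simp
  rcases le_abs.1 (show ε ≤ |S N ω / N - M| from hω) with h | h
  · left
    change N * (M + ε) ≤ S N ω
    rw [hS]
    gcongr
    linarith
  · right
    change N * (-M + ε) ≤ -S N ω
    rw [hS, ← mul_neg]
    gcongr
    linarith

theorem abs_integral_sub_le {Ω : Type*} [MeasurableSpace Ω] {μ : Measure Ω}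
    [IsProbabilityMeasure μ] {X : Ω → ℝ} (hX : AEMeasurable X μ) {C : ℝ} (hC : ∀ ω, |X ω| ≤ C)
    (M : ℝ) {ε : ℝ} (hε : 0 ≤ ε) :
    |∫ ω, X ω ∂μ - M| ≤ ε + (C + |M|) * μ.real {ω | ε ≤ |X ω - M|} := by
  have hset : NullMeasurableSet {ω | ε ≤ |X ω - M|} μ :=
    nullMeasurableSet_le aemeasurable_const (hX.sub_const M).abs
  have hXi : Integrable X μ := .of_bound hX.aestronglyMeasurable C (ae_of_all _ hC)
  calc |∫ ω, X ω ∂μ - M| = ‖∫ ω, (X ω - M) ∂μ‖ := by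
        rw [integral_sub hXi (integrable_const M), Real.norm_eq_abs]; simp
    _ ≤ ∫ ω, (ε + {ω | ε ≤ |X ω - M|}.indicator (fun _ => C + |M|) ω) ∂μ := by
        refine norm_integral_le_of_norm_le
          ((integrable_const ε).add ((integrable_const _).indicator₀ hset))
          (ae_of_all _ fun ω => ?_)
        have habs : |X ω - M| ≤ C + |M| := (abs_sub _ _).trans (by gcongr; exact hC ω)
        by_cases h : ε ≤ |X ω - M|
        · simpa [h] using habs.trans (le_add_of_nonneg_left hε)
        · simpa [h] using (not_le.1 h).le
    _ = ε + (C + |M|) * μ.real {ω | ε ≤ |X ω - M|} := by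
        rw [integral_add (integrable_const ε) ((integrable_const _).indicator₀ hset),
          integral_indicator₀ hset]
        simp [mul_comm]

theorem tendsto_integral_of_decaysExponentially [∀ N, IsProbabilityMeasure (μ N)]
    {X : (N : ℕ) → Ω N → ℝ} (hX : ∀ N, AEMeasurable (X N) (μ N)) {C : ℝ} (hC : ∀ N ω, |X N ω| ≤ C)
    (hdecay : ∀ ε, 0 < ε → DecaysExponentially fun N => (μ N).real {ω | ε ≤ |X N ω - M|}) :
    Tendsto (fun N => ∫ ω, X N ω ∂μ N) atTop (𝓝 M) := by
  refine Metric.tendsto_nhds.2 fun ε hε => ?_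
  have hlim : Tendsto (fun N => ε / 2 + (C + |M|) * (μ N).real {ω | ε / 2 ≤ |X N ω - M|}) atTop
      (𝓝 (ε / 2)) := by
    simpa using (((hdecay (ε / 2) (half_pos hε)).tendsto_zero fun N =>
      measureReal_nonneg).const_mul (C + |M|)).const_add (ε / 2)
  filter_upwards [hlim.eventually_lt_const (half_lt_self hε)] with N hN
  exact (abs_integral_sub_le (hX N) (hC N) M (half_pos hε).le).trans_lt hN

end Concentration

/-! ### Maximizers and subgradients -/

/-- A form of Berge's maximum theorem. -/
theorem continuousAt_of_unique_maximizer {X Y : Type*} [TopologicalSpace X] [TopologicalSpace Y]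
    {K : Set Y} (hK : IsCompact K) {F : X → Y → ℝ} (hF : Continuous fun q : X × Y => F q.1 q.2)
    {ζ : X → Y} (hζ : ∀ x, ζ x ∈ K) (hmax : ∀ x, IsMaxOn (F x) K (ζ x)) {x₀ : X}
    (hunique : ∀ y ∈ K, IsMaxOn (F x₀) K y → y = ζ x₀) : ContinuousAt ζ x₀ := by
  refine hK.tendsto_nhds_of_unique_mapClusterPt (Eventually.of_forall hζ) fun y hy hcluster =>
    hunique y hy fun y' hy' => ?_
  change F x₀ y' ≤ F x₀ y
  by_contra! hlt
  have hF' : Continuous fun q : X × Y => F q.1 y' :=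
    hF.comp (continuous_fst.prodMk continuous_const)
  have hnear : ∀ᶠ q : X × Y in 𝓝 x₀ ×ˢ 𝓝 y, F q.1 q.2 < F q.1 y' := by
    rw [← nhds_prod_eq]
    exact (hF.continuousAt (x := (x₀, y))).eventually_lt hF'.continuousAt hlt
  obtain ⟨p, hp, q, hq, hpq⟩ := eventually_prod_iff.1 hnear
  obtain ⟨x, hqx, hpx⟩ := ((mapClusterPt_iff_frequently.1 hcluster _ hq).and_eventually hp).exists
  exact (hpq hpx hqx).not_ge (hmax x hy')

/-- `D x` is a subgradient of `p` at every point `x`. -/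
def IsSubgradientSelection (p D : ℝ → ℝ) : Prop := ∀ x y, p x + D x * (y - x) ≤ p y

theorem isSubgradientSelection_of_hasDerivAt {p D : ℝ → ℝ} (hp : ∀ x, HasDerivAt p (D x) x)
    (hD : Monotone D) : IsSubgradientSelection p D := by
  have hconv : ConvexOn ℝ Set.univ p := Monotone.convexOn_univ_of_deriv
    (fun x => (hp x).differentiableAt) (by rwa [funext fun x => (hp x).deriv])
  intro x y
  rcases lt_trichotomy x y with h | rfl | h
  · have hslope := hconv.le_slope_of_hasDerivAt (Set.mem_univ x) (Set.mem_univ y) h (hp x)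
    rw [slope_def_field, le_div_iff₀ (sub_pos.2 h)] at hslope
    linarith
  · simp
  · have hslope := hconv.slope_le_of_hasDerivAt (Set.mem_univ y) (Set.mem_univ x) h (hp x)
    rw [slope_def_field, div_le_iff₀ (sub_pos.2 h)] at hslope
    linarith

namespace IsSubgradientSelection

variable {p D : ℝ → ℝ}

theorem monotone (h : IsSubgradientSelection p D) : Monotone D := by
  intro x y hxy
  rcases hxy.eq_or_lt with rfl | hlt
  · exact le_rfl
  · exact le_of_mul_le_mul_right (by linarith [h x y, h y x]) (sub_pos.2 hlt)

theorem hasDerivAt (h : IsSubgradientSelection p D) {x : ℝ} (hD : ContinuousAt D x) :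
    HasDerivAt p (D x) x := by
  rw [hasDerivAt_iff_isLittleO, Asymptotics.isLittleO_iff]
  intro c hc
  filter_upwards [hD.eventually (Metric.ball_mem_nhds _ hc)] with y hy
  have hmul : (D y - D x) * (y - x) ≤ c * |y - x| :=
    (le_abs_self _).trans (by rw [abs_mul]; gcongr; exact hy.le)
  rw [Real.norm_eq_abs, Real.norm_eq_abs, smul_eq_mul, abs_of_nonneg (by linarith [h x y])]
  linarith [h y x]

theorem apply_zero_le_of_even (h : IsSubgradientSelection p D) (heven : ∀ x, p (-x) = p x)
    (x : ℝ) : p 0 ≤ p x := by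
  have hneg := h 0 (-x)
  rw [heven] at hneg
  linarith [h 0 x]

theorem nonneg_of_even (h : IsSubgradientSelection p D) (heven : ∀ x, p (-x) = p x) {x : ℝ}
    (hx : 0 < x) : 0 ≤ D x :=
  nonneg_of_mul_nonneg_left (by linarith [h x 0, h.apply_zero_le_of_even heven x]) hx

theorem hasDerivAt_zero_of_even (h : IsSubgradientSelection p D) (heven : ∀ x, p (-x) = p x)
    (hD : Tendsto D (𝓝[>] 0) (𝓝 0)) : HasDerivAt p 0 0 := by
  rw [hasDerivAt_iff_isLittleO, Asymptotics.isLittleO_iff]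
  intro c hc
  obtain ⟨δ, hδ, hDc⟩ := mem_nhdsGT_iff_exists_Ioo_subset.1 (hD.eventually_lt_const hc)
  filter_upwards [Metric.ball_mem_nhds 0 hδ] with y hy
  simp only [sub_zero, smul_zero, Real.norm_eq_abs]
  rw [abs_of_nonneg (sub_nonneg.2 (h.apply_zero_le_of_even heven y))]
  rcases eq_or_ne y 0 with rfl | hy0
  · simp
  have hlt : D |y| < c := hDc ⟨abs_pos.2 hy0, by simpa using hy⟩
  have habs : p |y| = p y := by rcases abs_choice y with h | h <;> rw [h]; exact heven y
  have hsub := h |y| 0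
  rw [habs] at hsub
  linarith [mul_le_mul_of_nonneg_right hlt.le (abs_nonneg y)]

end IsSubgradientSelection

/-! ### Hyperbolic functions -/

/-- The log-partition function `log (e^x + e^{-x})` of a single spin in the field `x`. -/
def logTwoCosh (x : ℝ) : ℝ := Real.log (2 * Real.cosh x)

theorem exp_logTwoCosh (x : ℝ) : Real.exp (logTwoCosh x) = Real.exp x + Real.exp (-x) := by
  rw [logTwoCosh, Real.exp_log (mul_pos two_pos (Real.cosh_pos x)), Real.cosh_eq]
  ring

theorem logTwoCosh_neg (x : ℝ) : logTwoCosh (-x) = logTwoCosh x := by simp [logTwoCosh]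

theorem logTwoCosh_lt_of_abs_lt {x y : ℝ} (h : |x| < |y|) : logTwoCosh x < logTwoCosh y :=
  Real.log_lt_log (mul_pos two_pos (Real.cosh_pos x)) (by linarith [Real.cosh_lt_cosh.2 h])

theorem hasDerivAt_logTwoCosh (x : ℝ) : HasDerivAt logTwoCosh (Real.tanh x) x := by
  have h := ((Real.hasDerivAt_cosh x).const_mul 2).log (mul_pos two_pos (Real.cosh_pos x)).ne'
  rwa [mul_div_mul_left _ _ two_ne_zero, ← Real.tanh_eq_sinh_div_cosh] at h

theorem hasDerivAt_tanh (x : ℝ) : HasDerivAt Real.tanh (1 / Real.cosh x ^ 2) x := by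
  have h := (Real.hasDerivAt_sinh x).div (Real.hasDerivAt_cosh x) (Real.cosh_pos x).ne'
  rw [← sq, ← sq, Real.cosh_sq_sub_sinh_sq] at h
  exact h.congr_of_eventuallyEq (.of_forall Real.tanh_eq_sinh_div_cosh)

theorem tanh_pos {x : ℝ} (hx : 0 < x) : 0 < Real.tanh x := by
  rw [Real.tanh_eq_sinh_div_cosh]
  exact div_pos (Real.sinh_pos_iff.2 hx) (Real.cosh_pos x)

theorem monotone_tanh : Monotone Real.tanh :=
  monotone_of_hasDerivAt_nonneg hasDerivAt_tanh fun x => by positivity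

theorem isSubgradientSelection_logTwoCosh : IsSubgradientSelection logTwoCosh Real.tanh :=
  isSubgradientSelection_of_hasDerivAt hasDerivAt_logTwoCosh monotone_tanh

theorem lipschitzWith_logTwoCosh : LipschitzWith 1 logTwoCosh :=
  lipschitzWith_of_nnnorm_deriv_le (fun x => (hasDerivAt_logTwoCosh x).differentiableAt) fun x => by
    rw [(hasDerivAt_logTwoCosh x).deriv]
    exact (Real.abs_tanh_lt_one x).le

theorem lipschitzWith_tanh : LipschitzWith 1 Real.tanh :=
  lipschitzWith_of_nnnorm_deriv_le (fun x => (hasDerivAt_tanh x).differentiableAt) fun x => by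
    rw [(hasDerivAt_tanh x).deriv, ← NNReal.coe_le_coe, coe_nnnorm,
      Real.norm_of_nonneg (by positivity)]
    exact div_le_one_of_le₀ (one_le_pow₀ (Real.one_le_cosh x)) (by positivity)

theorem concaveOn_tanh : ConcaveOn ℝ (Set.Ici 0) Real.tanh := by
  refine AntitoneOn.concaveOn_of_deriv (convex_Ici 0) lipschitzWith_tanh.continuous.continuousOn
    (fun x _ => (hasDerivAt_tanh x).differentiableAt.differentiableWithinAt) ?_
  intro x hx y hy hxy
  rw [interior_Ici] at hx hy
  rw [(hasDerivAt_tanh x).deriv, (hasDerivAt_tanh y).deriv]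
  have hcosh : Real.cosh x ≤ Real.cosh y :=
    Real.cosh_le_cosh.2 (by rwa [abs_of_pos hx, abs_of_pos hy])
  have := Real.cosh_pos x
  gcongr

/-- By concavity, `u ↦ tanh (u x + B) / u` is strictly decreasing. -/
theorem mul_tanh_affine_lt {u v x B : ℝ} (hu : 0 < u) (huv : u < v) (hx : 0 ≤ x) (hB : 0 < B) :
    u * Real.tanh (v * x + B) < v * Real.tanh (u * x + B) := by
  have hv : 0 < v := hu.trans huv
  have hconc := concaveOn_tanh.2 (show B ∈ Set.Ici 0 from hB.le)
    (show v * x + B ∈ Set.Ici 0 from (by positivity : 0 ≤ v * x + B))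
    (sub_nonneg.2 ((div_le_one hv).2 huv.le)) (div_pos hu hv).le (sub_add_cancel 1 (u / v))
  have hpoint : (1 - u / v) * B + u / v * (v * x + B) = u * x + B := by field_simp; ring
  simp only [smul_eq_mul, hpoint] at hconc
  have hpos : 0 < (1 - u / v) * Real.tanh B :=
    mul_pos (sub_pos.2 ((div_lt_one hv).2 huv)) (tanh_pos hB)
  have hlt : u / v * Real.tanh (v * x + B) < Real.tanh (u * x + B) := by linarith
  rwa [div_mul_eq_mul_div, div_lt_iff₀' hv] at hlt

/-! ### The limiting variational problem -/

section Variational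

variable {Ω : Type*} [MeasurableSpace Ω] {P : Measure Ω} {W : Ω → ℝ}

theorem integral_comp_pos (hW0 : 0 ≤ᵐ[P] W) (hW : Integrable W P) (hpos : 0 < ∫ ω, W ω ∂P)
    {g : ℝ → ℝ} (h0 : 0 ≤ g 0) (hg : ∀ x, 0 < x → 0 < g x)
    (hint : Integrable (fun ω => g (W ω)) P) : 0 < ∫ ω, g (W ω) ∂P := by
  have hsupp := (integral_pos_iff_support_of_nonneg_ae hW0 hW).1 hpos
  rw [integral_pos_iff_support_of_nonneg_ae ?_ hint]
  · refine hsupp.trans_le (measure_mono_ae ?_)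
    filter_upwards [hW0] with ω hω hne
    exact (hg _ (lt_of_le_of_ne hω (Ne.symm hne))).ne'
  · filter_upwards [hW0] with ω hω
    rcases hω.eq_or_lt with h | h
    · exact h ▸ h0
    · exact (hg _ h).le

/-- The functional `z ↦ E[log (2 cosh (a z W + B))] - a E[W] z² / 2`, whose maximum is the pressure
of the inhomogeneous Curie-Weiss model with coupling `a` and weight distribution `W`. -/
def variational (P : Measure Ω) (W : Ω → ℝ) (a B z : ℝ) : ℝ :=
  ∫ ω, logTwoCosh (a * z * W ω + B) ∂P - a * (∫ ω, W ω ∂P) * z ^ 2 / 2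

/-- The maximum of the functional `variational`. It is attained, see `exists_isMaximizer`. -/
def pressure (P : Measure Ω) (W : Ω → ℝ) (a B : ℝ) : ℝ := ⨆ z, variational P W a B z

/-- The point `z` maximizes the functional `variational`. -/
def IsMaximizer (P : Measure Ω) (W : Ω → ℝ) (a B z : ℝ) : Prop :=
  ∀ y, variational P W a B y ≤ variational P W a B z

theorem IsMaximizer.pressure_eq {a B z : ℝ} (hz : IsMaximizer P W a B z) :
    pressure P W a B = variational P W a B z :=
  le_antisymm (ciSup_le hz) (le_ciSup ⟨_, Set.forall_mem_range.2 hz⟩ z)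

theorem IsMaximizer.variational_le_pressure {a B z : ℝ} (hz : IsMaximizer P W a B z) (y : ℝ) :
    variational P W a B y ≤ pressure P W a B := (hz y).trans_eq hz.pressure_eq.symm

theorem variational_neg (a B z : ℝ) : variational P W a (-B) (-z) = variational P W a B z := by
  have h (ω : Ω) : a * -z * W ω + -B = -(a * z * W ω + B) := by ring
  simp only [variational, h, logTwoCosh_neg, neg_sq]

theorem pressure_neg (a B : ℝ) : pressure P W a (-B) = pressure P W a B :=
  (Equiv.neg ℝ).surjective.iSup_congr _ fun z => by
    rw [Equiv.neg_apply, ← variational_neg a B, neg_neg]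

variable [IsFiniteMeasure P]

theorem integrable_comp_affine {K : NNReal} {f : ℝ → ℝ} (hf : LipschitzWith K f)
    (hW : Integrable W P) (u B : ℝ) : Integrable (fun ω => f (u * W ω + B)) P := by
  have haff : Integrable (fun ω => u * W ω + B) P := (hW.const_mul u).add (integrable_const B)
  refine ((haff.abs.const_mul K).add (integrable_const |f 0|)).mono'
    (hf.continuous.comp_aestronglyMeasurable haff.1) (ae_of_all _ fun ω => ?_)
  have h := hf.norm_sub_le (u * W ω + B) 0
  rw [sub_zero] at h
  exact (norm_le_norm_sub_add _ (f 0)).trans (add_le_add_left h _)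

theorem abs_integral_comp_affine_sub_le {K : NNReal} {f : ℝ → ℝ} (hf : LipschitzWith K f)
    (hW : Integrable W P) (u u' B B' : ℝ) :
    |∫ ω, f (u * W ω + B) ∂P - ∫ ω, f (u' * W ω + B') ∂P|
      ≤ K * (|u - u'| * ∫ ω, |W ω| ∂P + |B - B'| * P.real Set.univ) := by
  have hbound : Integrable (fun ω => |u - u'| * |W ω| + |B - B'|) P :=
    (hW.abs.const_mul _).add (integrable_const _)
  rw [← integral_sub (integrable_comp_affine hf hW u B) (integrable_comp_affine hf hW u' B')]
  calc ‖∫ ω, (f (u * W ω + B) - f (u' * W ω + B')) ∂P‖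
      ≤ ∫ ω, K * (|u - u'| * |W ω| + |B - B'|) ∂P := by
        refine norm_integral_le_of_norm_le (hbound.const_mul _) (ae_of_all _ fun ω => ?_)
        refine (hf.norm_sub_le _ _).trans (mul_le_mul_of_nonneg_left ?_ K.coe_nonneg)
        rw [← abs_mul, Real.norm_eq_abs]
        exact (abs_add_le _ _).trans_eq' (by ring_nf)
    _ = K * (|u - u'| * ∫ ω, |W ω| ∂P + |B - B'| * P.real Set.univ) := by
        rw [integral_const_mul, integral_add (hW.abs.const_mul _) (integrable_const _),
          integral_const_mul, integral_const, smul_eq_mul, mul_comm (P.real _)]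

theorem continuous_integral_comp_affine {K : NNReal} {f : ℝ → ℝ} (hf : LipschitzWith K f)
    (hW : Integrable W P) : Continuous fun q : ℝ × ℝ => ∫ ω, f (q.1 * W ω + q.2) ∂P := by
  refine continuous_iff_continuousAt.2 fun q => tendsto_iff_norm_sub_tendsto_zero.2 ?_
  have hbound : Continuous fun r : ℝ × ℝ =>
      K * (|r.1 - q.1| * ∫ ω, |W ω| ∂P + |r.2 - q.2| * P.real Set.univ) := by fun_prop
  exact squeeze_zero (fun _ => norm_nonneg _)
    (fun r => abs_integral_comp_affine_sub_le hf hW r.1 q.1 r.2 q.2)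
    ((hbound.tendsto q).trans_eq (by simp))

theorem continuous_variational (hW : Integrable W P) (a : ℝ) :
    Continuous fun q : ℝ × ℝ => variational P W a q.1 q.2 := by
  have h := (continuous_integral_comp_affine lipschitzWith_logTwoCosh hW).comp
    (by fun_prop : Continuous fun q : ℝ × ℝ => (a * q.2, q.1))
  exact h.sub (by fun_prop)

/-- Since `logTwoCosh` is `1`-Lipschitz, the quadratic term wins outside of `[-1, 1]`. -/
theorem variational_le_variational_projIcc (hW0 : 0 ≤ᵐ[P] W) (hW : Integrable W P) {a : ℝ}
    (ha : 0 ≤ a) (B z : ℝ) : variational P W a B z ≤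
      variational P W a B (Set.projIcc (-1) 1 (neg_le_self zero_le_one) z) := by
  set z₀ : ℝ := (Set.projIcc (-1) 1 (neg_le_self zero_le_one) z).1 with hz₀
  have hquad : 2 * |z - z₀| ≤ z ^ 2 - z₀ ^ 2 := by
    rcases le_total z (-1) with h | h
    · rw [Set.projIcc_of_le_left _ h] at hz₀
      rw [hz₀, abs_of_nonpos (by linarith)]
      nlinarith
    rcases le_total z 1 with h' | h'
    · rw [Set.projIcc_of_mem _ ⟨h, h'⟩] at hz₀
      simp [hz₀]
    · rw [Set.projIcc_of_right_le _ h'] at hz₀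
      rw [hz₀, abs_of_nonneg (by linarith)]
      nlinarith
  have hmean : ∫ ω, |W ω| ∂P = ∫ ω, W ω ∂P :=
    integral_congr_ae (hW0.mono fun ω hω => abs_of_nonneg hω)
  have hlip := abs_integral_comp_affine_sub_le lipschitzWith_logTwoCosh hW (a * z) (a * z₀) B B
  rw [NNReal.coe_one, one_mul, sub_self, abs_zero, zero_mul, add_zero, ← mul_sub, abs_mul,
    abs_of_nonneg ha, hmean] at hlip
  have hmul := mul_le_mul_of_nonneg_left hquad (mul_nonneg ha (integral_nonneg_of_ae hW0))
  rw [variational, variational]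
  linarith [le_of_abs_le hlip]

theorem isMaximizer_of_isMaxOn_Icc (hW0 : 0 ≤ᵐ[P] W) (hW : Integrable W P) {a : ℝ}
    (ha : 0 ≤ a) {B z : ℝ} (hz : IsMaxOn (variational P W a B) (Set.Icc (-1) 1) z) :
    IsMaximizer P W a B z := fun y =>
  (variational_le_variational_projIcc hW0 hW ha B y).trans (hz (Subtype.coe_prop _))

theorem exists_isMaximizer (hW0 : 0 ≤ᵐ[P] W) (hW : Integrable W P) {a : ℝ} (ha : 0 ≤ a) (B : ℝ) :
    ∃ z ∈ Set.Icc (-1 : ℝ) 1, IsMaximizer P W a B z := by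
  obtain ⟨z, hz, hmax⟩ := isCompact_Icc.exists_isMaxOn
    (Set.nonempty_Icc.2 (by norm_num : (-1 : ℝ) ≤ 1))
    ((continuous_variational hW a).comp (Continuous.prodMk_right B)).continuousOn
  exact ⟨z, hz, isMaximizer_of_isMaxOn_Icc hW0 hW ha hmax⟩

theorem integrable_mul_tanh (hW : Integrable W P) (u B : ℝ) :
    Integrable (fun ω => W ω * Real.tanh (u * W ω + B)) P :=
  hW.mul_bdd (c := 1) (integrable_comp_affine lipschitzWith_tanh hW u B).1
    (ae_of_all _ fun _ => (Real.abs_tanh_lt_one _).le)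

theorem hasDerivAt_variational (hW : Integrable W P) (a B z : ℝ) :
    HasDerivAt (variational P W a B)
      (a * ∫ ω, W ω * Real.tanh (a * z * W ω + B) ∂P - a * (∫ ω, W ω ∂P) * z) z := by
  refine HasDerivAt.sub ?_ ?_
  · rw [← integral_const_mul]
    refine (hasDerivAt_integral_of_dominated_loc_of_deriv_le (bound := fun ω => |a * W ω|)
      (F' := fun z ω => a * (W ω * Real.tanh (a * z * W ω + B))) univ_mem
      (.of_forall fun z => (integrable_comp_affine lipschitzWith_logTwoCosh hW _ _).1)
      (integrable_comp_affine lipschitzWith_logTwoCosh hW _ _)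
      ((integrable_mul_tanh hW _ _).const_mul a).1 (ae_of_all _ fun ω y _ => ?_)
      (hW.const_mul a).abs (ae_of_all _ fun ω y _ => ?_)).2
    · rw [← mul_assoc, Real.norm_eq_abs, abs_mul]
      exact mul_le_of_le_one_right (abs_nonneg _) (Real.abs_tanh_lt_one _).le
    · have haff : HasDerivAt (fun y => a * y * W ω + B) (a * W ω) y := by
        simpa using (((hasDerivAt_id y).const_mul a).mul_const (W ω)).add_const B
      have h := (hasDerivAt_logTwoCosh (a * y * W ω + B)).comp y haff
      exact h.congr_deriv (by ring)
  · exact (((hasDerivAt_pow 2 z).const_mul _).div_const 2).congr_deriv (by norm_num; ring)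

namespace IsMaximizer

variable {a B z z' : ℝ}

theorem integral_mul_tanh_eq (hW : Integrable W P) (ha : 0 < a) (hz : IsMaximizer P W a B z) :
    ∫ ω, W ω * Real.tanh (a * z * W ω + B) ∂P = (∫ ω, W ω ∂P) * z := by
  have hmax : IsLocalMax (variational P W a B) z := .of_forall hz
  have h := hmax.hasDerivAt_eq_zero (hasDerivAt_variational hW a B z)
  exact mul_left_cancel₀ ha.ne' (by linarith)

protected theorem pos (hW0 : 0 ≤ᵐ[P] W) (hW : Integrable W P) (hpos : 0 < ∫ ω, W ω ∂P)
    (ha : 0 < a) (hB : 0 < B) (hz : IsMaximizer P W a B z) : 0 < z := by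
  by_contra! hz0
  rcases hz0.eq_or_lt with rfl | hlt
  · have h := hz.integral_mul_tanh_eq hW ha
    simp only [mul_zero, zero_mul, zero_add, integral_mul_const] at h
    exact (mul_pos hpos (tanh_pos hB)).ne' h
  · have hint (y : ℝ) := integrable_comp_affine lipschitzWith_logTwoCosh hW (a * y) B
    have hlog := integral_comp_pos hW0 hW hpos
      (g := fun x => logTwoCosh (a * -z * x + B) - logTwoCosh (a * z * x + B)) (by simp)
      (fun x hx => sub_pos.2 (logTwoCosh_lt_of_abs_lt ?_)) ((hint (-z)).sub (hint z))
    · have hle := hz (-z)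
      rw [integral_sub (hint _) (hint _)] at hlog
      rw [variational, variational, neg_sq] at hle
      linarith
    · have hneg : 0 < a * -z * x := mul_pos (mul_pos ha (neg_pos.2 hlt)) hx
      rw [abs_of_pos (a := a * -z * x + B) (by linarith), abs_lt]
      constructor <;> linarith

/-- Two stationary points `z < z'` would contradict the monotonicity of `u ↦ tanh (u x + B) / u`. -/
theorem unique (hW0 : 0 ≤ᵐ[P] W) (hW : Integrable W P) (hpos : 0 < ∫ ω, W ω ∂P)
    (ha : 0 < a) (hB : 0 < B) (hz : IsMaximizer P W a B z) (hz' : IsMaximizer P W a B z') :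
    z = z' := by
  wlog hlt : z < z' generalizing z z'
  · rcases (not_lt.1 hlt).eq_or_lt with h | h
    · exact h.symm
    · exact (this hz' hz h).symm
  exfalso
  have hz0 := hz.pos hW0 hW hpos ha hB
  have hi := (integrable_mul_tanh hW (a * z) B).const_mul (a * z')
  have hi' := (integrable_mul_tanh hW (a * z') B).const_mul (a * z)
  have hlt' := integral_comp_pos hW0 hW hpos
    (g := fun x => a * z' * (x * Real.tanh (a * z * x + B)) -
      a * z * (x * Real.tanh (a * z' * x + B))) (by simp) (fun x hx => ?_) (hi.sub hi')
  · rw [integral_sub hi hi', integral_const_mul, integral_const_mul,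
      hz.integral_mul_tanh_eq hW ha, hz'.integral_mul_tanh_eq hW ha] at hlt'
    exact hlt'.ne' (by ring)
  · have hslope := mul_lt_mul_of_pos_left (mul_tanh_affine_lt (mul_pos ha hz0)
      (mul_lt_mul_of_pos_left hlt ha) hx.le hB) hx
    linarith

theorem continuousAt (hW0 : 0 ≤ᵐ[P] W) (hW : Integrable W P) (hpos : 0 < ∫ ω, W ω ∂P)
    (ha : 0 < a) (hB : 0 < B) {ζ : ℝ → ℝ} (hζ : ∀ B, ζ B ∈ Set.Icc (-1 : ℝ) 1)
    (hmax : ∀ B, IsMaximizer P W a B (ζ B)) : ContinuousAt ζ B :=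
  continuousAt_of_unique_maximizer isCompact_Icc (continuous_variational hW a) hζ
    (fun B y _ => hmax B y) fun _ _ hy =>
      (isMaximizer_of_isMaxOn_Icc hW0 hW ha.le hy).unique hW0 hW hpos ha hB (hmax B)

theorem isSubgradientSelection_pressure (hW : Integrable W P) {ζ : ℝ → ℝ}
    (hmax : ∀ B, IsMaximizer P W a B (ζ B)) : IsSubgradientSelection (pressure P W a)
      fun B => ∫ ω, Real.tanh (a * ζ B * W ω + B) ∂P := by
  intro B B'
  have hlog := integrable_comp_affine lipschitzWith_logTwoCosh hW (a * ζ B)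
  have htanh := integrable_comp_affine lipschitzWith_tanh hW (a * ζ B) B
  have hle : ∫ ω, (logTwoCosh (a * ζ B * W ω + B) + Real.tanh (a * ζ B * W ω + B) * (B' - B)) ∂P
      ≤ ∫ ω, logTwoCosh (a * ζ B * W ω + B') ∂P := by
    refine integral_mono ((hlog B).add (htanh.mul_const _)) (hlog B') fun ω => ?_
    simpa using isSubgradientSelection_logTwoCosh (a * ζ B * W ω + B) (a * ζ B * W ω + B')
  rw [integral_add (hlog B) (htanh.mul_const _), integral_mul_const] at hle
  refine le_trans ?_ ((hmax B').variational_le_pressure (ζ B))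
  rw [(hmax B).pressure_eq, variational, variational]
  linarith

theorem hasDerivAt_pressure (hW0 : 0 ≤ᵐ[P] W) (hW : Integrable W P) (hpos : 0 < ∫ ω, W ω ∂P)
    (ha : 0 ≤ a) (hB : 0 < B) {ζ : ℝ → ℝ} (hζ : ∀ B, ζ B ∈ Set.Icc (-1 : ℝ) 1)
    (hmax : ∀ B, IsMaximizer P W a B (ζ B)) :
    HasDerivAt (pressure P W a) (∫ ω, Real.tanh (a * ζ B * W ω + B) ∂P) B := by
  have hcont : ContinuousAt (fun B => a * ζ B) B := by
    rcases ha.eq_or_lt with rfl | ha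
    · simpa only [zero_mul] using continuousAt_const
    · exact (continuousAt hW0 hW hpos ha hB hζ hmax).const_mul a
  exact (isSubgradientSelection_pressure hW hmax).hasDerivAt
    ((continuous_integral_comp_affine lipschitzWith_tanh hW).continuousAt.comp
      (f := fun B => (a * ζ B, B)) (hcont.prodMk continuousAt_id))

end IsMaximizer

theorem differentiableAt_pressure (hW0 : 0 ≤ᵐ[P] W) (hW : Integrable W P)
    (hpos : 0 < ∫ ω, W ω ∂P) {a B : ℝ} (ha : 0 ≤ a) (hB : B ≠ 0) :
    DifferentiableAt ℝ (pressure P W a) B := by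
  choose ζ hζ hmax using exists_isMaximizer hW0 hW ha
  have hderiv {B : ℝ} (hB : 0 < B) :=
    IsMaximizer.hasDerivAt_pressure hW0 hW hpos ha hB hζ hmax
  rcases hB.lt_or_gt with h | h
  · rw [← funext (pressure_neg (P := P) (W := W) a)]
    exact (hasDerivAt_comp_neg (hderiv (neg_pos.2 h))).differentiableAt
  · exact (hderiv h).differentiableAt

end Variational

/-! ### The inhomogeneous Curie-Weiss model -/

section CurieWeiss

variable {N : ℕ} {w : Fin N → ℝ}

theorem spin_eq_one_or_neg_one (σ : SpinConfig N) (i : Fin N) : spin σ i = 1 ∨ spin σ i = -1 := by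
  rcases Int.units_eq_one_or (σ i) with h | h <;> simp [spin, h]

theorem abs_spin (σ : SpinConfig N) (i : Fin N) : |spin σ i| = 1 := by
  rcases spin_eq_one_or_neg_one σ i with h | h <;> simp [h]

theorem abs_totalSpin_le (σ : SpinConfig N) : |totalSpin σ| ≤ N :=
  (Finset.abs_sum_le_sum_abs _ _).trans (by simp [abs_spin])

/-- The weighted spin `∑ w_i σ_i`. -/
def weightedSpin (w : Fin N → ℝ) (σ : SpinConfig N) : ℝ := ∑ i, w i * spin σ i

/-- The Boltzmann factor of the inhomogeneous Curie-Weiss model, in which the vertices `i` and `j`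
interact with strength `a w_i w_j / ℓ_N`. The exponent includes the constant self-interactions. -/
def cwWeight (w : Fin N → ℝ) (a B : ℝ) (σ : SpinConfig N) : ℝ :=
  Real.exp (a * weightedSpin w σ ^ 2 / (2 * totalWeight w) + B * totalSpin σ)

/-- The partition function of the inhomogeneous Curie-Weiss model. -/
def cwPartition (w : Fin N → ℝ) (a B : ℝ) : ℝ := ∑ σ : SpinConfig N, cwWeight w a B σ

theorem cwPartition_pos (w : Fin N → ℝ) (a B : ℝ) : 0 < cwPartition w a B :=
  Finset.sum_pos (fun _ _ => Real.exp_pos _) Finset.univ_nonempty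

theorem totalWeight_pos (hw : ∀ i, 0 < w i) (hN : 0 < N) : 0 < totalWeight w :=
  Finset.sum_pos (fun i _ => hw i) ⟨⟨0, hN⟩, Finset.mem_univ _⟩

theorem abs_weightedSpin_le (hw : ∀ i, 0 ≤ w i) (σ : SpinConfig N) :
    |weightedSpin w σ| ≤ totalWeight w :=
  (Finset.abs_sum_le_sum_abs _ _).trans
    (Finset.sum_le_sum fun i _ => by rw [abs_mul, abs_spin, mul_one, abs_of_nonneg (hw i)])

theorem sum_exp_sum_mul_spin (h : Fin N → ℝ) :
    ∑ σ : SpinConfig N, Real.exp (∑ i, h i * spin σ i) = Real.exp (∑ i, logTwoCosh (h i)) := by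
  have hsingle (i) : Real.exp (logTwoCosh (h i)) = ∑ u : ℤˣ, Real.exp (h i * ((u : ℤ) : ℝ)) := by
    rw [exp_logTwoCosh]
    simp [UnitsInt.univ]
  simp_rw [Real.exp_sum, hsingle, Finset.prod_univ_sum, Fintype.piFinset_univ, spin]

theorem card_mul_variational (w : Fin N → ℝ) (a B z : ℝ) :
    N * variational (uniformOn Set.univ) w a B z =
      ∑ i, logTwoCosh (a * z * w i + B) - a * totalWeight w * z ^ 2 / 2 := by
  have h (f : Fin N → ℝ) : (N : ℝ) * ∫ i, f i ∂uniformOn Set.univ = ∑ i, f i := by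
    simpa using card_mul_integral_uniformOn_univ f
  rw [totalWeight, ← h, ← h, variational]
  ring

/-- The partition function of independent spins in the mean field `a z w_i + B`. -/
theorem sum_exp_linearized (w : Fin N → ℝ) (a B z : ℝ) :
    ∑ σ : SpinConfig N,
      Real.exp (a * z * weightedSpin w σ + B * totalSpin σ - a * totalWeight w * z ^ 2 / 2) =
    Real.exp (N * variational (uniformOn Set.univ) w a B z) := by
  simp only [card_mul_variational, Real.exp_sub, ← Finset.sum_div, ← sum_exp_sum_mul_spin]
  congr! 3 with σ
  rw [weightedSpin, totalSpin, Finset.mul_sum, Finset.mul_sum, ← Finset.sum_add_distrib]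
  exact Finset.sum_congr rfl fun i _ => by ring

theorem cwWeight_eq_linearized_mul (hl : totalWeight w ≠ 0) (a B z : ℝ) (σ : SpinConfig N) :
    cwWeight w a B σ =
      Real.exp (a * z * weightedSpin w σ + B * totalSpin σ - a * totalWeight w * z ^ 2 / 2) *
        Real.exp (a * totalWeight w * (weightedSpin w σ / totalWeight w - z) ^ 2 / 2) := by
  rw [cwWeight, ← Real.exp_add]
  congr 1
  field_simp
  ring

theorem exp_card_mul_variational_le_cwPartition (hl : 0 < totalWeight w) {a : ℝ} (ha : 0 ≤ a)
    (B z : ℝ) : Real.exp (N * variational (uniformOn Set.univ) w a B z) ≤ cwPartition w a B := by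
  rw [← sum_exp_linearized]
  refine Finset.sum_le_sum fun σ _ => ?_
  rw [cwWeight_eq_linearized_mul hl.ne' a B z]
  exact le_mul_of_one_le_right (Real.exp_pos _).le (Real.one_le_exp (by positivity))

theorem cwPartition_le_sum_of_net (hw : ∀ i, 0 ≤ w i) (hl : 0 < totalWeight w) {a : ℝ}
    (ha : 0 ≤ a) (B : ℝ) {T : Finset ℝ} {η : ℝ}
    (hT : ∀ y ∈ Set.Icc (-1 : ℝ) 1, ∃ z ∈ T, |y - z| ≤ η) :
    cwPartition w a B ≤ ∑ z ∈ T, Real.exp (N * variational (uniformOn Set.univ) w a B z) *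
      Real.exp (a * totalWeight w * η ^ 2 / 2) := by
  simp_rw [← sum_exp_linearized, Finset.sum_mul]
  rw [Finset.sum_comm]
  refine Finset.sum_le_sum fun σ _ => ?_
  obtain ⟨z, hzT, hz⟩ := hT (weightedSpin w σ / totalWeight w) (by
    rw [Set.mem_Icc, ← abs_le, abs_div, abs_of_pos hl]
    exact (div_le_one hl).2 (abs_weightedSpin_le hw σ))
  rw [cwWeight_eq_linearized_mul hl.ne' a B z]
  have hsq : (weightedSpin w σ / totalWeight w - z) ^ 2 ≤ η ^ 2 := by
    rw [← sq_abs]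
    exact pow_le_pow_left₀ (abs_nonneg _) hz 2
  calc _ ≤ Real.exp (a * z * weightedSpin w σ + B * totalSpin σ - a * totalWeight w * z ^ 2 / 2) *
        Real.exp (a * totalWeight w * η ^ 2 / 2) := by gcongr
    _ ≤ _ := Finset.single_le_sum (f := fun z =>
        Real.exp (a * z * weightedSpin w σ + B * totalSpin σ - a * totalWeight w * z ^ 2 / 2) *
          Real.exp (a * totalWeight w * η ^ 2 / 2)) (fun z _ => by positivity) hzT

theorem log_cwPartition_div_le (hw : ∀ i, 0 < w i) (hN : 0 < N) {a : ℝ} (ha : 0 ≤ a) {B c : ℝ}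
    {T : Finset ℝ} {η : ℝ} (hT : ∀ y ∈ Set.Icc (-1 : ℝ) 1, ∃ z ∈ T, |y - z| ≤ η)
    (hc : ∀ z ∈ T, variational (uniformOn Set.univ) w a B z ≤ c) :
    Real.log (cwPartition w a B) / N ≤
      Real.log T.card / N + a * (totalWeight w / N) * η ^ 2 / 2 + c := by
  have hN' : (0 : ℝ) < N := Nat.cast_pos.2 hN
  have hcard : (0 : ℝ) < T.card := by
    obtain ⟨z, hz, -⟩ := hT 0 (by simp)
    exact Nat.cast_pos.2 (Finset.card_pos.2 ⟨z, hz⟩)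
  have hZ : cwPartition w a B ≤
      T.card * Real.exp (N * c + a * totalWeight w * η ^ 2 / 2) := by
    refine (cwPartition_le_sum_of_net (fun i => (hw i).le) (totalWeight_pos hw hN) ha B hT).trans ?_
    rw [← nsmul_eq_mul]
    refine Finset.sum_le_card_nsmul _ _ _ fun z hz => ?_
    rw [← Real.exp_add]
    gcongr
    exact hc z hz
  have hlog := Real.log_le_log (cwPartition_pos w a B) hZ
  rw [Real.log_mul hcard.ne' (Real.exp_pos _).ne', Real.log_exp] at hlog
  refine (div_le_div_of_nonneg_right hlog hN'.le).trans_eq ?_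
  field_simp
  ring

end CurieWeiss

/-- First-moment weight regularity with limiting random variable `W`: the conditions on the first
moments in `WeightRegularity`, with the same index shift. -/
structure MeanRegularity (w : (N : ℕ) → Fin N → ℝ) {Ω : Type*} [MeasurableSpace Ω]
    (P : Measure Ω) [IsProbabilityMeasure P] (W : Ω → ℝ) : Prop where
  tendsto_dist : TendstoInDistribution (fun (N : ℕ) (i : Fin (N + 1)) => w (N + 1) i) atTop W
    (fun N : ℕ => uniformOn (Set.univ : Set (Fin (N + 1)))) P
  integrable : Integrable W P
  tendsto_mean : Tendsto (fun N : ℕ => totalWeight (w N) / N) atTop (𝓝 (∫ x, W x ∂P))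
  mean_pos : 0 < ∫ x, W x ∂P

namespace MeanRegularity

variable {w : (N : ℕ) → Fin N → ℝ} {Ω : Type*} [MeasurableSpace Ω] {P : Measure Ω}
  [IsProbabilityMeasure P] {W : Ω → ℝ}

theorem ae_nonneg (hreg : MeanRegularity w P W) (hw : ∀ N i, 0 ≤ w N i) : 0 ≤ᵐ[P] W :=
  ae_mem_of_tendstoInDistribution hreg.tendsto_dist isClosed_Ici fun N =>
    ae_of_all _ fun i => hw (N + 1) i

theorem tendsto_integral_comp (hreg : MeanRegularity w P W) (hw : ∀ N i, 0 ≤ w N i) {f : ℝ → ℝ}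
    (hf : Continuous f) {C K : ℝ} (hgrowth : ∀ x, |f x| ≤ C + K * |x|) :
    Tendsto (fun N => ∫ i, f (w N i) ∂uniformOn Set.univ) atTop (𝓝 (∫ x, f (W x) ∂P)) := by
  refine (tendsto_add_atTop_iff_nat 1).1 ?_
  refine tendsto_integral_comp_of_abs_le hreg.tendsto_dist hf (by fun_prop) hgrowth
    (fun N => .of_finite) ((integrable_const C).add (hreg.integrable.abs.const_mul K)) ?_
  have habs : ∫ x, |W x| ∂P = ∫ x, W x ∂P :=
    integral_congr_ae ((hreg.ae_nonneg hw).mono fun x hx => abs_of_nonneg hx)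
  have hmean (N : ℕ) : totalWeight (w (N + 1)) / ((N + 1 : ℕ) : ℝ) =
      ∫ i, |w (N + 1) i| ∂uniformOn Set.univ := by
    rw [div_eq_iff (by positivity), mul_comm]
    simpa [totalWeight, abs_of_nonneg (hw _ _)] using
      (card_mul_integral_uniformOn_univ fun i => |w (N + 1) i|).symm
  have hlim := ((tendsto_add_atTop_iff_nat 1).2 hreg.tendsto_mean).const_mul K |>.const_add C
  rw [integral_add (integrable_const C) (hreg.integrable.abs.const_mul K), integral_const_mul, habs,
    integral_const, probReal_univ, one_smul]
  refine hlim.congr fun N => ?_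
  rw [integral_add (integrable_const C) .of_finite, integral_const_mul, hmean]
  simp

theorem tendsto_variational (hreg : MeanRegularity w P W) (hw : ∀ N i, 0 ≤ w N i) (a B z : ℝ) :
    Tendsto (fun N => variational (uniformOn Set.univ) (w N) a B z) atTop
      (𝓝 (variational P W a B z)) := by
  have hlog := hreg.tendsto_integral_comp hw (f := fun x => logTwoCosh (a * z * x + B))
    (C := |logTwoCosh 0| + |B|) (K := |a * z|)
    (lipschitzWith_logTwoCosh.continuous.comp (by fun_prop)) fun x => by
      have h := lipschitzWith_logTwoCosh.norm_sub_le (a * z * x + B) 0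
      simp only [NNReal.coe_one, one_mul, sub_zero, Real.norm_eq_abs] at h
      have hsub := abs_sub_abs_le_abs_sub (logTwoCosh (a * z * x + B)) (logTwoCosh 0)
      have hadd := abs_add_le (a * z * x) B
      rw [abs_mul] at hadd
      linarith
  have hid := hreg.tendsto_integral_comp hw (f := id) (C := 0) (K := 1) continuous_id (by simp)
  exact hlog.sub (((hid.const_mul a).mul_const _).div_const 2)

theorem eventually_lt_log_cwPartition (hreg : MeanRegularity w P W) (hw : ∀ N i, 0 < w N i)
    {a : ℝ} (ha : 0 ≤ a) {B c z : ℝ} (hc : c < variational P W a B z) :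
    ∀ᶠ N : ℕ in atTop, c < Real.log (cwPartition (w N) a B) / N := by
  filter_upwards [(hreg.tendsto_variational (fun N i => (hw N i).le) a B z).eventually_const_lt hc,
    eventually_gt_atTop 0] with N hcN hN
  refine hcN.trans_le ((le_div_iff₀' (Nat.cast_pos.2 hN)).2 ?_)
  rw [Real.le_log_iff_exp_le (cwPartition_pos _ _ _)]
  exact exp_card_mul_variational_le_cwPartition (totalWeight_pos (hw N) hN) ha B z

theorem eventually_log_cwPartition_lt (hreg : MeanRegularity w P W) (hw : ∀ N i, 0 < w N i)
    {a : ℝ} (ha : 0 ≤ a) {B c p : ℝ} (hp : ∀ z, variational P W a B z ≤ p) (hc : p < c) :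
    ∀ᶠ N : ℕ in atTop, Real.log (cwPartition (w N) a B) / N < c := by
  obtain ⟨p', hpp', hp'c⟩ := exists_between hc
  obtain ⟨η, hηc, hη⟩ : ∃ η : ℝ, a * (∫ x, W x ∂P) * η ^ 2 / 2 + p' < c ∧ 0 < η := by
    have hlim : Tendsto (fun η : ℝ => a * (∫ x, W x ∂P) * η ^ 2 / 2 + p') (𝓝[>] 0) (𝓝 p') :=
      (Continuous.tendsto' (by fun_prop) 0 p' (by simp)).mono_left nhdsWithin_le_nhds
    exact ((hlim.eventually_lt_const hp'c).and self_mem_nhdsWithin).exists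
  obtain ⟨T, -, hTfin, hTcover⟩ :=
    (isCompact_Icc (a := (-1 : ℝ)) (b := 1)).finite_cover_balls hη
  lift T to Finset ℝ using hTfin
  have hnet (y) (hy : y ∈ Set.Icc (-1 : ℝ) 1) : ∃ z ∈ T, |y - z| ≤ η := by
    obtain ⟨z, hz, hyz⟩ := Set.mem_iUnion₂.1 (hTcover hy)
    exact ⟨z, hz, (Metric.mem_ball.1 hyz).le⟩
  have hlim : Tendsto (fun N : ℕ => Real.log T.card / N +
      a * (totalWeight (w N) / N) * η ^ 2 / 2 + p') atTop
      (𝓝 (0 + a * (∫ x, W x ∂P) * η ^ 2 / 2 + p')) :=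
    ((tendsto_const_div_atTop_nhds_zero_nat _).add
      (((hreg.tendsto_mean.const_mul a).mul_const _).div_const 2)).add_const p'
  have hvar : ∀ᶠ N in atTop, ∀ z ∈ T, variational (uniformOn Set.univ) (w N) a B z ≤ p' :=
    (eventually_all_finset T).2 fun z _ =>
      (hreg.tendsto_variational (fun N i => (hw N i).le) a B z).eventually_le_const
        ((hp z).trans_lt hpp')
  filter_upwards [hvar, hlim.eventually_lt_const (by rwa [zero_add]), eventually_gt_atTop 0]
    with N hvarN hltN hN
  exact (log_cwPartition_div_le (hw N) hN ha hnet hvarN).trans_lt hltN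

theorem tendsto_log_cwPartition (hreg : MeanRegularity w P W) (hw : ∀ N i, 0 < w N i) {a : ℝ}
    (ha : 0 ≤ a) (B : ℝ) : Tendsto (fun N : ℕ => Real.log (cwPartition (w N) a B) / N) atTop
      (𝓝 (pressure P W a B)) := by
  obtain ⟨z, -, hz⟩ :=
    exists_isMaximizer (hreg.ae_nonneg fun N i => (hw N i).le) hreg.integrable ha B
  rw [hz.pressure_eq]
  exact tendsto_order.2 ⟨fun c hc => hreg.eventually_lt_log_cwPartition hw ha hc,
    fun c hc => hreg.eventually_log_cwPartition_lt hw ha hz hc⟩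

end MeanRegularity

/-! ### The annealed weights of the generalized random graph -/

instance : MeasurableSingletonClass ℤˣ where
  measurableSet_singleton u :=
    ⟨{(u : ℤ)}, measurableSet_singleton _, by ext v; simp [Units.ext_iff]⟩

instance {V : Type*} [Countable V] : MeasurableSingletonClass (SimpleGraph V) where
  measurableSet_singleton G :=
    ⟨{G.Adj}, measurableSet_singleton _, by
      ext H
      simp only [Set.mem_preimage, Set.mem_singleton_iff, SimpleGraph.adj_inj]⟩

section AnnealedWeight

variable {N : ℕ} {w : Fin N → ℝ}

theorem sum_vertexPair (f : Fin N → Fin N → ℝ) :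
    ∑ e : VertexPair N, f e.1.1 e.1.2 = ∑ i, ∑ j, if i < j then f i j else 0 := by
  rw [← Fintype.sum_prod_type' fun i j => if i < j then f i j else 0, ← Finset.sum_filter]
  exact (Finset.sum_subtype _ (by simp) fun e : Fin N × Fin N => f e.1 e.2).symm

theorem two_mul_sum_vertexPair {f : Fin N → Fin N → ℝ} (hf : ∀ i j, f i j = f j i) :
    2 * ∑ e : VertexPair N, f e.1.1 e.1.2 = ∑ i, ∑ j, f i j - ∑ i, f i i := by
  have hsplit : ∑ i, ∑ j, f i j = ∑ i, ∑ j, (if i < j then f i j else 0)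
      + ∑ i, ∑ j, (if j < i then f i j else 0) + ∑ i, ∑ j, (if i = j then f i j else 0) := by
    simp only [← Finset.sum_add_distrib]
    refine Finset.sum_congr rfl fun i _ => Finset.sum_congr rfl fun j _ => ?_
    rcases lt_trichotomy i j with h | h | h
    · simp [h, h.not_gt, h.ne]
    · simp [h]
    · simp [h, h.not_gt, h.ne']
  have hswap : ∑ i, ∑ j, (if j < i then f i j else 0) = ∑ i, ∑ j, if i < j then f i j else 0 := by
    rw [Finset.sum_comm]
    simp only [hf]
  have hdiag : ∑ i, ∑ j, (if i = j then f i j else 0) = ∑ i, f i i := by simp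
  rw [sum_vertexPair, hsplit, hswap, hdiag]
  ring

/-- The product `σ_i σ_j` of the spins at the two vertices of a pair. -/
def bondSpin (σ : SpinConfig N) (e : VertexPair N) : ℝ := spin σ e.1.1 * spin σ e.1.2

theorem bondSpin_eq_one_or_neg_one (σ : SpinConfig N) (e : VertexPair N) :
    bondSpin σ e = 1 ∨ bondSpin σ e = -1 := by
  rcases spin_eq_one_or_neg_one σ e.1.1 with h | h <;>
    rcases spin_eq_one_or_neg_one σ e.1.2 with h' | h' <;> simp [bondSpin, h, h']

theorem edgeInteraction_graphOfIndicators (X : VertexPair N → Bool) (σ : SpinConfig N) :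
    edgeInteraction (graphOfIndicators X) σ = ∑ e, if X e then bondSpin σ e else 0 := by
  classical
  let F (i j : Fin N) : ℝ :=
    if ∃ h : i < j, X ⟨(i, j), h⟩ = true then spin σ i * spin σ j else 0
  have hF (e : VertexPair N) : (if X e then bondSpin σ e else 0) = F e.1.1 e.1.2 :=
    if_congr ⟨fun he => ⟨e.2, he⟩, fun ⟨_, he⟩ => he⟩ rfl rfl
  simp_rw [hF]
  rw [sum_vertexPair F, edgeInteraction]
  refine Finset.sum_congr rfl fun i _ => Finset.sum_congr rfl fun j _ => ?_
  by_cases hij : i < j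
  · have : (graphOfIndicators X).Adj i j ↔ ∃ h : i < j, X ⟨(i, j), h⟩ = true := by
      simp [graphOfIndicators, hij.ne, hij, hij.not_gt]
    simp [hij, this, F]
  · simp [hij]

theorem measurable_graphOfIndicators :
    Measurable (graphOfIndicators : (VertexPair N → Bool) → SimpleGraph (Fin N)) :=
  measurable_of_finite _

instance (w : Fin N → ℝ) : IsProbabilityMeasure (grgLaw w) :=
  Measure.isProbabilityMeasure_map measurable_graphOfIndicators.aemeasurable

/-- The unnormalized annealed weight of a spin configuration. -/
def annealedWeight (w : Fin N → ℝ) (β B : ℝ) (σ : SpinConfig N) : ℝ :=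
  ∫ G, boltzmannFactor β B G σ ∂grgLaw w

/-- The annealed partition function. -/
def annealedPartition (w : Fin N → ℝ) (β B : ℝ) : ℝ := ∑ σ : SpinConfig N, annealedWeight w β B σ

theorem annealedWeight_eq_prod_edgeProb (w : Fin N → ℝ) (β B : ℝ) (σ : SpinConfig N) :
    annealedWeight w β B σ = Real.exp (B * totalSpin σ) *
      ∏ e : VertexPair N, ((edgeProb w e.1.1 e.1.2 : ℝ) * Real.exp (β * bondSpin σ e)
        + (1 - (edgeProb w e.1.1 e.1.2 : ℝ))) := by
  let F (e : VertexPair N) (b : Bool) : ℝ := if b then Real.exp (β * bondSpin σ e) else 1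
  have hfactor (X : VertexPair N → Bool) : boltzmannFactor β B (graphOfIndicators X) σ =
      Real.exp (B * totalSpin σ) * ∏ e, F e (X e) := by
    rw [boltzmannFactor, edgeInteraction_graphOfIndicators, Real.exp_add, mul_comm,
      Finset.mul_sum, Real.exp_sum]
    congr 1
    refine Finset.prod_congr rfl fun e _ => ?_
    cases X e <;> simp [F]
  rw [annealedWeight, grgLaw, integral_map measurable_graphOfIndicators.aemeasurable
    (measurable_of_finite _).aestronglyMeasurable]
  simp_rw [hfactor]
  rw [integral_const_mul, integral_fintype_prod_eq_prod]
  congr 1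
  refine Finset.prod_congr rfl fun e _ => ?_
  rw [integral_bernoulliMeasure]
  simp [F]

theorem annealedWeight_pos (w : Fin N → ℝ) (β B : ℝ) (σ : SpinConfig N) :
    0 < annealedWeight w β B σ :=
  integral_exp_pos .of_finite

theorem annealedPartition_pos (w : Fin N → ℝ) (β B : ℝ) : 0 < annealedPartition w β B :=
  Finset.sum_pos (fun σ _ => annealedWeight_pos w β B σ) Finset.univ_nonempty

theorem annealedWeight_add (w : Fin N → ℝ) (β B t : ℝ) (σ : SpinConfig N) :
    annealedWeight w β (B + t) σ = annealedWeight w β B σ * Real.exp (t * totalSpin σ) := by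
  simp only [annealedWeight, ← integral_mul_const, boltzmannFactor, ← Real.exp_add]
  congr! 3
  ring

/-! ### Comparison of the annealed and the Curie-Weiss weights -/

/-- The odds `w_i w_j / ℓ_N` of the presence of an edge. -/
def edgeOdds (w : Fin N → ℝ) (e : VertexPair N) : ℝ := w e.1.1 * w e.1.2 / totalWeight w

theorem edgeOdds_nonneg (hw : ∀ i, 0 ≤ w i) (e : VertexPair N) : 0 ≤ edgeOdds w e :=
  div_nonneg (mul_nonneg (hw _) (hw _)) (Finset.sum_nonneg fun i _ => hw i)

theorem annealedWeight_eq_prod_edgeOdds (hw : ∀ i, 0 < w i) (β B : ℝ) (σ : SpinConfig N) :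
    annealedWeight w β B σ = Real.exp (B * totalSpin σ) *
      ∏ e, (1 + edgeOdds w e * Real.exp (β * bondSpin σ e)) / (1 + edgeOdds w e) := by
  rw [annealedWeight_eq_prod_edgeProb]
  congr 1
  refine Finset.prod_congr rfl fun e _ => ?_
  have hl : 0 < totalWeight w := totalWeight_pos hw e.1.1.pos
  have hprod : 0 < w e.1.1 * w e.1.2 := mul_pos (hw _) (hw _)
  rw [coe_edgeProb hw, edgeOdds]
  field_simp
  ring

theorem sum_edgeOdds_mul_bondSpin (w : Fin N → ℝ) (σ : SpinConfig N) :
    ∑ e, edgeOdds w e * bondSpin σ e =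
      (weightedSpin w σ ^ 2 - ∑ i, w i ^ 2) / (2 * totalWeight w) := by
  have h := two_mul_sum_vertexPair
    (f := fun i j => w i * w j / totalWeight w * (spin σ i * spin σ j)) fun i j => by ring
  have hsq : ∑ i, ∑ j, w i * w j / totalWeight w * (spin σ i * spin σ j) =
      weightedSpin w σ ^ 2 / totalWeight w := by
    simp only [weightedSpin, sq, Finset.sum_mul_sum, Finset.sum_div]
    exact Finset.sum_congr rfl fun i _ => Finset.sum_congr rfl fun j _ => by ring
  have hdiag : ∑ i, w i * w i / totalWeight w * (spin σ i * spin σ i) =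
      (∑ i, w i ^ 2) / totalWeight w := by
    rw [Finset.sum_div]
    refine Finset.sum_congr rfl fun i _ => ?_
    rw [← abs_mul_abs_self (spin σ i), abs_spin]
    ring
  rw [hsq, hdiag] at h
  rw [mul_comm 2, ← div_div, sub_div, ← h, mul_div_cancel_left₀ _ two_ne_zero]
  rfl

theorem min_one_mul_div_le {u v l : ℝ} (hu : 0 ≤ u) (hv : 0 ≤ v) (hl : 0 ≤ l) :
    min 1 (u * v / l) ≤ min 1 (u ^ 2 / l) + min 1 (v ^ 2 / l) := by
  have hu' : 0 ≤ min 1 (u ^ 2 / l) := by positivity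
  have hv' : 0 ≤ min 1 (v ^ 2 / l) := by positivity
  rcases le_total u v with h | h
  · exact le_add_of_nonneg_of_le hu' (by rw [sq]; gcongr)
  · exact le_add_of_le_of_nonneg (by rw [sq]; gcongr) hv'

theorem sum_edgeOdds_mul_min_le (hw : ∀ i, 0 ≤ w i) :
    ∑ e, edgeOdds w e * min 1 (edgeOdds w e) ≤ ∑ i, w i * min 1 (w i ^ 2 / totalWeight w) := by
  have hl : 0 ≤ totalWeight w := Finset.sum_nonneg fun i _ => hw i
  have hodds (i j) : 0 ≤ w i * w j / totalWeight w := div_nonneg (mul_nonneg (hw i) (hw j)) hl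
  let g (i : Fin N) : ℝ := w i * min 1 (w i ^ 2 / totalWeight w)
  have hg (i) : 0 ≤ g i := mul_nonneg (hw i) (by positivity)
  have hpair := two_mul_sum_vertexPair (f := fun i j =>
    w i * w j / totalWeight w * min 1 (w i * w j / totalWeight w)) fun i j => by
      rw [mul_comm (w i)]
  have hdiag : 0 ≤ ∑ i, w i * w i / totalWeight w * min 1 (w i * w i / totalWeight w) :=
    Finset.sum_nonneg fun i _ => mul_nonneg (hodds i i) (le_min zero_le_one (hodds i i))
  have hdouble : ∑ i, ∑ j, w i * w j / totalWeight w * min 1 (w i * w j / totalWeight w) ≤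
      2 * ∑ i, g i :=
    calc _ ≤ ∑ i, ∑ j, (g i * (w j / totalWeight w) + g j * (w i / totalWeight w)) := by
          refine Finset.sum_le_sum fun i _ => Finset.sum_le_sum fun j _ => ?_
          refine (mul_le_mul_of_nonneg_left (min_one_mul_div_le (hw i) (hw j) hl)
            (hodds i j)).trans_eq ?_
          ring
      _ = 2 * (∑ i, g i) * (totalWeight w / totalWeight w) := by
          simp only [Finset.sum_add_distrib, ← Finset.sum_mul, ← Finset.mul_sum,
            ← Finset.sum_div]
          rw [totalWeight]
          ring
      _ ≤ 2 * ∑ i, g i := mul_le_of_le_one_right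
          (mul_nonneg zero_le_two (Finset.sum_nonneg fun i _ => hg i)) (div_self_le_one _)
  simp only [edgeOdds]
  linarith

/-- The spin-independent ratio between the annealed and the Curie-Weiss weights, to leading
order. -/
def annealedPrefactor (w : Fin N → ℝ) (β : ℝ) : ℝ :=
  (∏ e, Real.exp (edgeOdds w e * Real.cosh β) / (1 + edgeOdds w e)) *
    Real.exp (-(Real.sinh β * (∑ i, w i ^ 2) / (2 * totalWeight w)))

theorem annealedPrefactor_pos (hw : ∀ i, 0 ≤ w i) (β : ℝ) : 0 < annealedPrefactor w β :=
  mul_pos (Finset.prod_pos fun e _ => div_pos (Real.exp_pos _)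
    (add_pos_of_pos_of_nonneg one_pos (edgeOdds_nonneg hw e))) (Real.exp_pos _)

theorem exp_mul_of_eq_one_or_neg_one (β : ℝ) {s : ℝ} (hs : s = 1 ∨ s = -1) :
    Real.exp (β * s) = Real.cosh β + Real.sinh β * s := by
  rcases hs with rfl | rfl
  · rw [mul_one, mul_one, Real.cosh_add_sinh]
  · rw [mul_neg_one, mul_neg_one, ← sub_eq_add_neg, Real.cosh_sub_sinh]

theorem annealedPrefactor_mul_cwWeight (w : Fin N → ℝ) (β B : ℝ) (σ : SpinConfig N) :
    annealedPrefactor w β * cwWeight w (Real.sinh β) B σ = Real.exp (B * totalSpin σ) *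
      ∏ e, Real.exp (edgeOdds w e * Real.exp (β * bondSpin σ e)) / (1 + edgeOdds w e) := by
  have hsplit (e) : Real.exp (edgeOdds w e * Real.exp (β * bondSpin σ e)) / (1 + edgeOdds w e) =
      Real.exp (edgeOdds w e * Real.cosh β) / (1 + edgeOdds w e) *
        Real.exp (Real.sinh β * (edgeOdds w e * bondSpin σ e)) := by
    rw [exp_mul_of_eq_one_or_neg_one β (bondSpin_eq_one_or_neg_one σ e), mul_add, Real.exp_add,
      mul_left_comm, mul_div_right_comm]
  simp_rw [hsplit]
  rw [Finset.prod_mul_distrib, ← Real.exp_sum, ← Finset.mul_sum, sum_edgeOdds_mul_bondSpin,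
    annealedPrefactor, cwWeight, mul_assoc, ← Real.exp_add, mul_left_comm, ← Real.exp_add]
  congr 2
  ring

theorem annealedWeight_le (hw : ∀ i, 0 < w i) (β B : ℝ) (σ : SpinConfig N) :
    annealedWeight w β B σ ≤ annealedPrefactor w β * cwWeight w (Real.sinh β) B σ := by
  rw [annealedPrefactor_mul_cwWeight, annealedWeight_eq_prod_edgeOdds hw]
  have hx (e) := edgeOdds_nonneg (fun i => (hw i).le) e
  gcongr with e
  · exact fun e _ => by have := hx e; positivity
  · have := hx e; positivity
  · linarith [Real.add_one_le_exp (edgeOdds w e * Real.exp (β * bondSpin σ e))]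

theorem exp_sub_mul_min_le_one_add {y : ℝ} (hy : 0 ≤ y) : Real.exp (y - y * min 1 y) ≤ 1 + y := by
  rw [← Real.le_log_iff_exp_le (by linarith)]
  refine le_trans ?_ (Real.one_sub_inv_le_log_of_pos (by linarith))
  have hinv : 1 - (1 + y)⁻¹ = y / (1 + y) := by field_simp; ring
  rw [hinv]
  rcases le_total 1 y with h | h
  · rw [min_eq_left h, mul_one, sub_self]
    positivity
  · rw [min_eq_right h, le_div_iff₀ (by linarith)]
    nlinarith [pow_nonneg hy 3]

/-- A bound for the logarithmic error of the comparison with the Curie-Weiss model. The truncation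
by `1` makes it `o(N)` under a first-moment condition alone. -/
def comparisonError (w : Fin N → ℝ) (β : ℝ) : ℝ :=
  Real.exp (2 * |β|) * ∑ i, w i * min 1 (w i ^ 2 / totalWeight w)

theorem sum_mul_min_le_comparisonError (hw : ∀ i, 0 ≤ w i) (β : ℝ) (σ : SpinConfig N) :
    ∑ e, edgeOdds w e * Real.exp (β * bondSpin σ e) *
      min 1 (edgeOdds w e * Real.exp (β * bondSpin σ e)) ≤ comparisonError w β := by
  refine le_trans ?_ (mul_le_mul_of_nonneg_left (sum_edgeOdds_mul_min_le hw) (Real.exp_pos _).le)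
  rw [Finset.mul_sum]
  refine Finset.sum_le_sum fun e _ => ?_
  have hx := edgeOdds_nonneg hw e
  have hC : 1 ≤ Real.exp |β| := Real.one_le_exp (abs_nonneg β)
  have hexp : Real.exp (β * bondSpin σ e) ≤ Real.exp |β| := by
    rw [Real.exp_le_exp]
    rcases bondSpin_eq_one_or_neg_one σ e with h | h <;> rw [h]
    · linarith [le_abs_self β]
    · linarith [neg_le_abs β]
  have hle : edgeOdds w e * Real.exp (β * bondSpin σ e) ≤ Real.exp |β| * edgeOdds w e := by
    rw [mul_comm]
    gcongr
  calc _ ≤ Real.exp |β| * edgeOdds w e * min 1 (Real.exp |β| * edgeOdds w e) := by gcongr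
    _ ≤ Real.exp |β| * edgeOdds w e * (Real.exp |β| * min 1 (edgeOdds w e)) := by
        rw [mul_min_of_nonneg _ _ (Real.exp_pos _).le, mul_one]
        gcongr
    _ = Real.exp (2 * |β|) * (edgeOdds w e * min 1 (edgeOdds w e)) := by
        rw [two_mul, Real.exp_add]
        ring

theorem exp_neg_comparisonError_mul_le_annealedWeight (hw : ∀ i, 0 < w i) (β B : ℝ)
    (σ : SpinConfig N) : Real.exp (-comparisonError w β) *
      (annealedPrefactor w β * cwWeight w (Real.sinh β) B σ) ≤ annealedWeight w β B σ := by
  set y := fun e => edgeOdds w e * Real.exp (β * bondSpin σ e)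
  have hx (e) := edgeOdds_nonneg (fun i => (hw i).le) e
  calc _ ≤ Real.exp (-∑ e, y e * min 1 (y e)) *
        (annealedPrefactor w β * cwWeight w (Real.sinh β) B σ) := by
        have := annealedPrefactor_pos (fun i => (hw i).le) β
        gcongr
        · exact mul_nonneg this.le (Real.exp_pos _).le
        · exact sum_mul_min_le_comparisonError (fun i => (hw i).le) β σ
    _ = Real.exp (B * totalSpin σ) *
          ∏ e, Real.exp (y e - y e * min 1 (y e)) / (1 + edgeOdds w e) := by
        rw [annealedPrefactor_mul_cwWeight, mul_left_comm, ← Finset.sum_neg_distrib, Real.exp_sum,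
          ← Finset.prod_mul_distrib]
        congr 1
        refine Finset.prod_congr rfl fun e _ => ?_
        rw [← mul_div_assoc, ← Real.exp_add, neg_add_eq_sub]
    _ ≤ annealedWeight w β B σ := by
        rw [annealedWeight_eq_prod_edgeOdds hw]
        gcongr with e
        · exact fun e _ => by have := hx e; positivity
        · have := hx e; positivity
        · exact exp_sub_mul_min_le_one_add (mul_nonneg (hx e) (Real.exp_pos _).le)

theorem abs_log_annealedPartition_sub_le (hw : ∀ i, 0 < w i) (β B : ℝ) :
    |Real.log (annealedPartition w β B) -
      (Real.log (annealedPrefactor w β) + Real.log (cwPartition w (Real.sinh β) B))|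
        ≤ comparisonError w β := by
  have hK := annealedPrefactor_pos (fun i => (hw i).le) β
  have hZ := cwPartition_pos w (Real.sinh β) B
  have hupper : annealedPartition w β B ≤
      annealedPrefactor w β * cwPartition w (Real.sinh β) B := by
    rw [cwPartition, Finset.mul_sum]
    exact Finset.sum_le_sum fun σ _ => annealedWeight_le hw β B σ
  have hlower : Real.exp (-comparisonError w β) *
      (annealedPrefactor w β * cwPartition w (Real.sinh β) B) ≤ annealedPartition w β B := by
    rw [cwPartition, Finset.mul_sum, Finset.mul_sum]
    exact Finset.sum_le_sum fun σ _ => exp_neg_comparisonError_mul_le_annealedWeight hw β B σ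
  have hlog_upper := Real.log_le_log (annealedPartition_pos w β B) hupper
  have hlog_lower := Real.log_le_log (by positivity) hlower
  rw [Real.log_mul (Real.exp_pos _).ne' (by positivity), Real.log_exp] at hlog_lower
  rw [← Real.log_mul hK.ne' hZ.ne', abs_le]
  constructor <;> linarith

end AnnealedWeight

/-! ### The annealed measure -/

section AnnealedMeasure

variable {N : ℕ}

theorem integral_partitionFunction (w : Fin N → ℝ) (β B : ℝ) :
    ∫ G, partitionFunction β B G ∂grgLaw w = annealedPartition w β B :=
  integral_finsetSum _ fun _ _ => .of_finite

theorem annealedProb_eq (w : Fin N → ℝ) (β B : ℝ) (σ : SpinConfig N) :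
    annealedProb w β B σ = annealedWeight w β B σ / annealedPartition w β B := by
  rw [annealedProb, integral_partitionFunction, annealedWeight]

theorem annealedProb_nonneg (w : Fin N → ℝ) (β B : ℝ) (σ : SpinConfig N) :
    0 ≤ annealedProb w β B σ := by
  rw [annealedProb_eq]
  exact (div_pos (annealedWeight_pos w β B σ) (annealedPartition_pos w β B)).le

theorem sum_annealedProb (w : Fin N → ℝ) (β B : ℝ) : ∑ σ, annealedProb w β B σ = 1 := by
  simp_rw [annealedProb_eq]
  rw [← Finset.sum_div]
  exact div_self (annealedPartition_pos w β B).ne'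

instance (w : Fin N → ℝ) (β B : ℝ) : IsProbabilityMeasure (annealedMeasure w β B) where
  measure_univ := by
    simp only [annealedMeasure, Measure.finsetSum_apply, Measure.smul_apply, measure_univ,
      smul_eq_mul, mul_one]
    rw [← ENNReal.ofReal_sum_of_nonneg fun σ _ => annealedProb_nonneg w β B σ, sum_annealedProb,
      ENNReal.ofReal_one]

theorem integral_annealedMeasure (w : Fin N → ℝ) (β B : ℝ) (f : SpinConfig N → ℝ) :
    ∫ σ, f σ ∂annealedMeasure w β B = ∑ σ, annealedProb w β B σ * f σ := by
  rw [annealedMeasure, integral_finsetSum_measure fun σ _ =>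
    (integrable_dirac (by simp)).smul_measure ENNReal.ofReal_ne_top]
  refine Finset.sum_congr rfl fun σ _ => ?_
  rw [integral_smul_measure, integral_dirac, ENNReal.toReal_ofReal (annealedProb_nonneg w β B σ),
    smul_eq_mul]

theorem cgf_totalSpin_annealedMeasure (w : Fin N → ℝ) (β B t : ℝ) :
    cgf totalSpin (annealedMeasure w β B) t =
      Real.log (annealedPartition w β (B + t)) - Real.log (annealedPartition w β B) := by
  rw [← Real.log_div (annealedPartition_pos w β _).ne' (annealedPartition_pos w β B).ne', cgf, mgf,
    integral_annealedMeasure, annealedPartition, Finset.sum_div]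
  congr 1
  refine Finset.sum_congr rfl fun σ _ => ?_
  rw [annealedWeight_add, annealedProb_eq, div_mul_eq_mul_div]

end AnnealedMeasure

namespace MeanRegularity

variable {w : (N : ℕ) → Fin N → ℝ} {Ω : Type*} [MeasurableSpace Ω] {P : Measure Ω}
  [IsProbabilityMeasure P] {W : Ω → ℝ}

theorem tendsto_totalWeight (hreg : MeanRegularity w P W) :
    Tendsto (fun N => totalWeight (w N)) atTop atTop := by
  refine (hreg.tendsto_mean.pos_mul_atTop hreg.mean_pos tendsto_natCast_atTop_atTop).congr' ?_
  filter_upwards [eventually_gt_atTop 0] with N hN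
  exact div_mul_cancel₀ _ (Nat.cast_pos.2 hN).ne'

theorem tendsto_sum_mul_min (hreg : MeanRegularity w P W) (hw : ∀ N i, 0 ≤ w N i) :
    Tendsto (fun N : ℕ => (∑ i, w N i * min 1 (w N i ^ 2 / totalWeight (w N))) / N) atTop
      (𝓝 0) := by
  refine tendsto_order.2 ⟨fun c hc => ?_, fun c hc => ?_⟩
  · filter_upwards [hreg.tendsto_totalWeight.eventually_ge_atTop 0] with N hl
    exact hc.trans_le (div_nonneg (Finset.sum_nonneg fun i _ =>
      mul_nonneg (hw N i) (by positivity)) N.cast_nonneg)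
  obtain ⟨T, hTc, hT⟩ := (((tendsto_integral_mul_min hreg.integrable).eventually_lt_const hc).and
    (eventually_gt_atTop 0)).exists
  have hlim := hreg.tendsto_integral_comp hw (f := fun x => x * min 1 (x ^ 2 / T)) (by fun_prop)
    (C := 0) (K := 1) fun x => by
      have hmin : 0 ≤ min 1 (x ^ 2 / T) := by positivity
      rw [abs_mul, abs_of_nonneg hmin, zero_add, one_mul]
      exact mul_le_of_le_one_right (abs_nonneg _) (min_le_left _ _)
  filter_upwards [hlim.eventually_lt_const hTc, hreg.tendsto_totalWeight.eventually_ge_atTop T,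
    eventually_gt_atTop 0] with N hN hl hpos
  refine lt_of_le_of_lt ?_ hN
  rw [div_le_iff₀' (Nat.cast_pos.2 hpos)]
  have hcard := card_mul_integral_uniformOn_univ fun i => w N i * min 1 (w N i ^ 2 / T)
  rw [Fintype.card_fin] at hcard
  rw [hcard]
  refine Finset.sum_le_sum fun i _ => mul_le_mul_of_nonneg_left ?_ (hw N i)
  gcongr

theorem tendsto_cgf_totalSpin (hreg : MeanRegularity w P W) (hw : ∀ N i, 0 < w N i) {β : ℝ}
    (hβ : 0 ≤ β) (B t : ℝ) :
    Tendsto (fun N : ℕ => cgf totalSpin (annealedMeasure (w N) β B) t / N) atTop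
      (𝓝 (pressure P W (Real.sinh β) (B + t) - pressure P W (Real.sinh β) B)) := by
  have ha : 0 ≤ Real.sinh β := Real.sinh_nonneg_iff.2 hβ
  have herr : Tendsto (fun N : ℕ => 2 * (comparisonError (w N) β / N)) atTop (𝓝 0) := by
    simpa only [comparisonError, mul_div_assoc, mul_zero] using
      ((hreg.tendsto_sum_mul_min fun N i => (hw N i).le).const_mul (Real.exp (2 * |β|))).const_mul 2
  have hcw := (hreg.tendsto_log_cwPartition hw ha (B + t)).sub
    (hreg.tendsto_log_cwPartition hw ha B)
  refine tendsto_of_tendsto_of_dist hcw (squeeze_zero (fun _ => dist_nonneg) (fun N => ?_) herr)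
  have h := abs_le.1 (abs_log_annealedPartition_sub_le (hw N) β B)
  have h' := abs_le.1 (abs_log_annealedPartition_sub_le (hw N) β (B + t))
  rw [cgf_totalSpin_annealedMeasure, Real.dist_eq, ← sub_div, ← sub_div, abs_div, Nat.abs_cast,
    ← mul_div_assoc]
  refine div_le_div_of_nonneg_right (abs_le.2 ⟨?_, ?_⟩) N.cast_nonneg <;> linarith

theorem decaysExponentially_of_hasDerivAt_pressure (hreg : MeanRegularity w P W)
    (hw : ∀ N i, 0 < w N i) {β B M : ℝ} (hβ : 0 ≤ β)
    (hM : HasDerivAt (pressure P W (Real.sinh β)) M B) {ε : ℝ} (hε : 0 < ε) :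
    DecaysExponentially fun N =>
      (annealedMeasure (w N) β B).real {σ | ε ≤ |totalSpin σ / (N : ℝ) - M|} :=
  decaysExponentially_measureReal_abs_sub_ge (fun _ _ => .of_finite)
    (hreg.tendsto_cgf_totalSpin hw hβ B) (by simp)
    ((HasDerivAt.comp_const_add B 0 (by rwa [add_zero])).sub_const _) hε

theorem isLimitMagnetization_of_hasDerivAt_pressure (hreg : MeanRegularity w P W)
    (hw : ∀ N i, 0 < w N i) {β B M : ℝ} (hβ : 0 ≤ β)
    (hM : HasDerivAt (pressure P W (Real.sinh β)) M B) : IsLimitMagnetization w β B M :=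
  tendsto_integral_of_decaysExponentially (C := 1) (fun _ => (measurable_of_finite _).aemeasurable)
    (fun N σ => by
      rw [abs_div, Nat.abs_cast]
      exact div_le_one_of_le₀ (abs_totalSpin_le σ) N.cast_nonneg)
    fun _ hε => hreg.decaysExponentially_of_hasDerivAt_pressure hw hβ hM hε

/-! ### The uniqueness regime -/

theorem hasDerivAt_pressure_zero (hreg : MeanRegularity w P W) (hw : ∀ N i, 0 < w N i) {β : ℝ}
    (hβ : 0 < β) (hβc : (β : EReal) < criticalInverseTemperature w) :
    HasDerivAt (pressure P W (Real.sinh β)) 0 0 := by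
  have ha : 0 ≤ Real.sinh β := Real.sinh_nonneg_iff.2 hβ.le
  have hW0 := hreg.ae_nonneg fun N i => (hw N i).le
  choose ζ hζ hmax using exists_isMaximizer hW0 hreg.integrable ha
  have hsel := IsMaximizer.isSubgradientSelection_pressure hreg.integrable hmax
  have hderiv (B : ℝ) (hB : 0 < B) :=
    IsMaximizer.hasDerivAt_pressure hW0 hreg.integrable hreg.mean_pos ha hB hζ hmax
  have hlim := hsel.monotone.tendsto_nhdsGT 0
  set m := sInf ((fun B => ∫ x, Real.tanh (Real.sinh β * ζ B * W x + B) ∂P) '' Set.Ioi 0)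
  have hspont : IsSpontaneousMagnetization w β m :=
    ⟨_, fun B hB => hreg.isLimitMagnetization_of_hasDerivAt_pressure hw hβ.le (hderiv B hB), hlim⟩
  have hm : m = 0 := by
    refine le_antisymm (not_lt.1 fun hm => hβc.not_ge (sInf_le ⟨β, rfl, hβ, m, hm, hspont⟩)) ?_
    exact ge_of_tendsto hlim (eventually_nhdsWithin_of_forall fun B hB =>
      hsel.nonneg_of_even (pressure_neg _) hB)
  exact hsel.hasDerivAt_zero_of_even (pressure_neg _) (hm ▸ hlim)

theorem differentiableAt_pressure_of_mem_uniquenessRegime (hreg : MeanRegularity w P W)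
    (hw : ∀ N i, 0 < w N i) {β B : ℝ} (hβB : (β, B) ∈ uniquenessRegime w) :
    DifferentiableAt ℝ (pressure P W (Real.sinh β)) B := by
  rcases hβB with ⟨hβ, hB⟩ | ⟨hβ, hβc, rfl : B = 0⟩
  · exact differentiableAt_pressure (hreg.ae_nonneg fun N i => (hw N i).le) hreg.integrable
      hreg.mean_pos (Real.sinh_nonneg_iff.2 hβ) hB
  · exact (hreg.hasDerivAt_pressure_zero hw hβ hβc).differentiableAt

end MeanRegularity

theorem WeightRegularity.meanRegularity {w : (N : ℕ) → Fin N → ℝ} {Ω : Type*} [MeasurableSpace Ω]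
    {P : Measure Ω} [IsProbabilityMeasure P] {W : Ω → ℝ} (hreg : WeightRegularity w P W) :
    MeanRegularity w P W where
  tendsto_dist := hreg.tendsto_dist
  integrable := hreg.integrable
  tendsto_mean := by simpa [totalWeight, div_eq_inv_mul] using hreg.tendsto_mean
  mean_pos := hreg.mean_pos

theorem nonneg_of_mem_uniquenessRegime {w : (N : ℕ) → Fin N → ℝ} {β B : ℝ}
    (h : (β, B) ∈ uniquenessRegime w) : 0 ≤ β :=
  h.elim And.left fun h => h.1.le

end

end AnnealedIsing

theorem mainTheorem7_general {Ω : Type*} [MeasurableSpace Ω] (P : Measure Ω)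
    [IsProbabilityMeasure P] (W : Ω → ℝ) (w : (N : ℕ) → Fin N → ℝ) (hw : ∀ N i, 0 < w N i)
    (hreg : AnnealedIsing.MeanRegularity w P W) (β B : ℝ)
    (hβB : (β, B) ∈ AnnealedIsing.uniquenessRegime w) :
    ∃ M : ℝ, AnnealedIsing.IsLimitMagnetization w β B M ∧
      ∀ ε : ℝ, 0 < ε → ∃ L : ℝ, 0 < L ∧ ∀ᶠ N : ℕ in atTop,
        (AnnealedIsing.annealedMeasure (w N) β B).real
            {σ | ε ≤ |AnnealedIsing.totalSpin σ / (N : ℝ) - M|}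
          ≤ Real.exp (-((N : ℝ) * L)) := by
  have hβ : 0 ≤ β := AnnealedIsing.nonneg_of_mem_uniquenessRegime hβB
  have hM := (hreg.differentiableAt_pressure_of_mem_uniquenessRegime hw hβB).hasDerivAt
  exact ⟨_, hreg.isLimitMagnetization_of_hasDerivAt_pressure hw hβ hM,
    fun ε hε => hreg.decaysExponentially_of_hasDerivAt_pressure hw hβ hM hε⟩

theorem mainTheorem7 {Ω : Type*} [MeasurableSpace Ω] (P : Measure Ω) [IsProbabilityMeasure P]
    (W : Ω → ℝ) (w : (N : ℕ) → Fin N → ℝ) (hw : ∀ N i, 0 < w N i)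
    (hreg : AnnealedIsing.WeightRegularity w P W) (β B : ℝ)
    (hβB : (β, B) ∈ AnnealedIsing.uniquenessRegime w) :
    ∃ M : ℝ, AnnealedIsing.IsLimitMagnetization w β B M ∧
      ∀ ε : ℝ, 0 < ε → ∃ L : ℝ, 0 < L ∧ ∀ᶠ N : ℕ in atTop,
        (AnnealedIsing.annealedMeasure (w N) β B).real
            {σ | ε ≤ |AnnealedIsing.totalSpin σ / (N : ℝ) - M|}
          ≤ Real.exp (-((N : ℝ) * L)) :=
  mainTheorem7_general P W w hw hreg.meanRegularity β B hβB
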